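/- Let $\mathcal F$ be a family of finite simple graphs, and for a vertex $v$ of a graph let $N(v,i)$ be the number of self-avoiding walks of length $i$ starting at $v$. We say that the connective constant of $\mathcal F$ is at most $\Delta$, with constants $a$ and $c$, if for every $G=(V,E)\in\mathcal F$, every $v\in V$ and every integer $\ell\ge 0$ with $\ell\ge a\log|V|$ we have $\sum_{i=1}^{\ell}N(v,i)\le c\,\Delta^{\ell}$. For a dimer activity $\gamma>0$, the monomer-dimer partition function of $G$ is $Z_\gamma(G)=\sum_{M}\gamma^{|M|}$, the sum being over all matchings $M$ of $G$. Theorem. For every real $a$ there is a constant $K$ such that the following holds. Let $\gamma>0$, $\Delta\ge 1$ and $c$ be real, and let $\mathcal F$ be a family of finite graphs whose connective constant is at most $\Delta$ with constants $a$ and $c$. Then there are a deterministic algorithm and a constant $C$ such that, for every $G\in\mathcal F$ with $n\ge 1$ vertices and every $0<\varepsilon\le 1$, the algorithm, given the adjacency matrix of $G$ and the integer $\lceil 1/\varepsilon\rceil$, outputs a fraction $\hat Z$ with $$(1-\varepsilon)\,Z_\gamma(G)\le \hat Z\le (1+\varepsilon)\,Z_\gamma(G)$$ in time at most $$C\left(\frac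 n\varepsilon\right)^{K\left(1+(1+\sqrt{\gamma\Delta})\log\Delta\right)} .$$ In particular, for fixed $\gamma$ and $\mathcal F$ this is an FPTAS for $Z_\gamma$ on $\mathcal F$; when $\Delta\ge 2$ and $\gamma\Delta\ge 1$ the exponent is $O(\sqrt{\gamma\Delta}\,\log\Delta)$, with a constant depending only on $a$. Here an algorithm is a program for a random access machine on natural numbers with logarithmic cost (every instruction is charged one more than the total bit length of the numbers it handles), which can access the real number $\gamma$ only by computing $\lfloor\gamma x\rfloor$ for natural numbers $x$, charged by the bit lengths of $x$ and of the answer. -/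

import Mathlib

noncomputable section

namespace MonomerDimer

/-! ### Monomer-dimer model and connective constant -/

/-- `M` is a matching of `G`: a set of edges of `G`, no two of which share a vertex. -/
def IsMatchingSet {V : Type*} (G : SimpleGraph V) (M : Finset (Sym2 V)) : Prop :=
  (∀ e ∈ M, e ∈ G.edgeSet) ∧
    ∀ e ∈ M, ∀ e' ∈ M, e ≠ e' → ∀ v : V, ¬(v ∈ e ∧ v ∈ e')

open Classical in
/-- The monomer-dimer partition function `∑ γ ^ |M|` over all matchings `M` of `G`. -/
def partitionFunction {V : Type*} [Fintype V] (γ : ℝ) (G : SimpleGraph V) : ℝ :=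
  ∑ M : Finset (Sym2 V) with IsMatchingSet G M, γ ^ M.card

/-- The number of self-avoiding walks of length `l` in `G` that start at `v`. -/
def numSAW {V : Type*} [Fintype V] (G : SimpleGraph V) (v : V) (l : ℕ) : ℕ :=
  ∑ w : V, Set.ncard {p : G.Walk v w | p.IsPath ∧ p.length = l}

/-- A finite graph: a number `n` of vertices and a simple graph on `{0, …, n - 1}`. -/
abbrev FinGraph : Type := Σ n : ℕ, SimpleGraph (Fin n)

/-- The connective constant of the family `F` of finite graphs is at most `Δ`, with witnessing
constants `a` and `c`: for every graph in `F` on `n` vertices, every vertex `v` and every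
`l ≥ a log n`, at most `c Δ ^ l` self-avoiding walks start at `v` and have length
between `1` and `l`. -/
def ConnectiveConstantAtMost (F : Set FinGraph) (Δ a c : ℝ) : Prop :=
  ∀ G ∈ F, ∀ v : Fin G.1, ∀ l : ℕ, a * Real.log (G.1 : ℝ) ≤ (l : ℝ) →
    ((∑ i ∈ Finset.Icc 1 l, numSAW G.2 v i : ℕ) : ℝ) ≤ c * Δ ^ l

/-! ### Random access machines with logarithmic cost

Deterministic random access programs on natural numbers. A program has finitely many registers
and arrays, named by the numerals that occur in it. Each instruction is charged one more than the
total bit length of the numbers that it handles. A real parameter `γ` is available to programs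
only through the integers `⌊γ x⌋`, charged by the bit lengths of `x` and of the answer. -/

/-- The contents of the registers and of the arrays. -/
structure Store where
  reg : ℕ → ℕ
  arr : ℕ → ℕ → ℕ

/-- Set register `d` to `x`. -/
def Store.setReg (s : Store) (d x : ℕ) : Store :=
  { s with reg := Function.update s.reg d x }

/-- Set entry `i` of array `k` to `x`. -/
def Store.setArr (s : Store) (k i x : ℕ) : Store :=
  { s with arr := Function.update s.arr k (Function.update (s.arr k) i x) }

/-- The arithmetic operations; subtraction is truncated at zero and division rounds down. -/
inductive ArithOp where
  | add | sub | mul | div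

/-- The value of an arithmetic operation. -/
def ArithOp.eval : ArithOp → ℕ → ℕ → ℕ
  | .add, x, y => x + y
  | .sub, x, y => x - y
  | .mul, x, y => x * y
  | .div, x, y => x / y

/-- Programs. -/
inductive Prog where
  /-- do nothing -/
  | skip
  /-- register `d` := the constant `k` -/
  | const (d k : ℕ)
  /-- register `d` := register `x` -/
  | copy (d x : ℕ)
  /-- register `d` := register `x` (op) register `y` -/
  | arith (op : ArithOp) (d x y : ℕ)
  /-- register `d` := the entry of array `k` whose index is in register `i` -/
  | load (d k i : ℕ)
  /-- the entry of array `k` whose index is in register `i` := register `x` -/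
  | store (k i x : ℕ)
  /-- register `d` := the floor of `γ` times register `x` -/
  | param (d x : ℕ)
  /-- sequential composition -/
  | seq (P Q : Prog)
  /-- if register `x` is nonzero then `P` else `Q` -/
  | ite (x : ℕ) (P Q : Prog)
  /-- while register `x` is nonzero do `P` -/
  | loop (x : ℕ) (P : Prog)

/-- `Runs γ P s t s'`: with parameter `γ`, the program `P` started in the store `s` halts in the
store `s'`, and the total cost of the run is `t`. -/
inductive Runs (γ : ℝ) : Prog → Store → ℕ → Store → Prop where
  | skip (s : Store) : Runs γ .skip s 1 s
  | const (s : Store) (d k : ℕ) :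
      Runs γ (.const d k) s (1 + Nat.size k) (s.setReg d k)
  | copy (s : Store) (d x : ℕ) :
      Runs γ (.copy d x) s (1 + Nat.size (s.reg x)) (s.setReg d (s.reg x))
  | arith (s : Store) (op : ArithOp) (d x y : ℕ) :
      Runs γ (.arith op d x y) s (1 + Nat.size (s.reg x) + Nat.size (s.reg y))
        (s.setReg d (op.eval (s.reg x) (s.reg y)))
  | load (s : Store) (d k i : ℕ) :
      Runs γ (.load d k i) s
        (1 + Nat.size (s.reg i) + Nat.size (s.arr k (s.reg i)))
        (s.setReg d (s.arr k (s.reg i)))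
  | store (s : Store) (k i x : ℕ) :
      Runs γ (.store k i x) s (1 + Nat.size (s.reg i) + Nat.size (s.reg x))
        (s.setArr k (s.reg i) (s.reg x))
  | param (s : Store) (d x : ℕ) :
      Runs γ (.param d x) s
        (1 + Nat.size (s.reg x) + Nat.size ⌊γ * (s.reg x : ℝ)⌋₊)
        (s.setReg d ⌊γ * (s.reg x : ℝ)⌋₊)
  | seq {P Q : Prog} {s s' s'' : Store} {t t' : ℕ} :
      Runs γ P s t s' → Runs γ Q s' t' s'' → Runs γ (.seq P Q) s (t + t') s''
  | ite_true {x : ℕ} {P Q : Prog} {s s' : Store} {t : ℕ} :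
      s.reg x ≠ 0 → Runs γ P s t s' →
        Runs γ (.ite x P Q) s (1 + Nat.size (s.reg x) + t) s'
  | ite_false {x : ℕ} {P Q : Prog} {s s' : Store} {t : ℕ} :
      s.reg x = 0 → Runs γ Q s t s' →
        Runs γ (.ite x P Q) s (1 + Nat.size (s.reg x) + t) s'
  | loop_exit {x : ℕ} {P : Prog} {s : Store} :
      s.reg x = 0 → Runs γ (.loop x P) s (1 + Nat.size (s.reg x)) s
  | loop_step {x : ℕ} {P : Prog} {s s' s'' : Store} {t t' : ℕ} :
      s.reg x ≠ 0 → Runs γ P s t s' → Runs γ (.loop x P) s' t' s'' →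
        Runs γ (.loop x P) s (1 + Nat.size (s.reg x) + t + t') s''

open Classical in
/-- The input for a graph `G` on `n` vertices and an accuracy `1 / m`: register `0` holds `n`,
register `1` holds `m`, array `0` holds the adjacency matrix of `G` row by row, and everything
else is zero. -/
def inputStore (G : FinGraph) (m : ℕ) : Store where
  reg := fun r => if r = 0 then G.1 else if r = 1 then m else 0
  arr := fun k x =>
    if k = 0 ∧ ∃ i j : Fin G.1, x = (i : ℕ) * G.1 + (j : ℕ) ∧ G.2.Adj i j then 1 else 0

/-- The output: the fraction (register `0`) / (register `1`). -/
def output (s : Store) : ℝ := (s.reg 0 : ℝ) / (s.reg 1 : ℝ)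

/-- On every graph of the family `F` with `n ≥ 1` vertices, and for every accuracy
`0 < ε ≤ 1`, the program `P`, which is given the graph and the integer `⌈1/ε⌉`, halts after cost at
most `T n ε` with a fraction that approximates the monomer-dimer partition function with edge
activity `γ` up to a factor `1 ± ε`. -/
def ApproximatesInTime (γ : ℝ) (F : Set FinGraph) (P : Prog) (T : ℕ → ℝ → ℝ) : Prop :=
  ∀ G ∈ F, 0 < G.1 → ∀ ε : ℝ, 0 < ε → ε ≤ 1 →
    ∃ (t : ℕ) (s : Store), Runs γ P (inputStore G ⌈1 / ε⌉₊) t s ∧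
      (t : ℝ) ≤ T G.1 ε ∧
      s.reg 1 ≠ 0 ∧
      (1 - ε) * partitionFunction γ G.2 ≤ output s ∧
      output s ≤ (1 + ε) * partitionFunction γ G.2

end MonomerDimer

end

namespace MonomerDimer
open Finset

/-! ### A contraction estimate for the monomer-dimer recurrence -/

/-! Removing the vertices one at a time writes `Z` as the product of `1 / x` over the vertices,
where `x` is the probability that the vertex is uncovered by a random matching of the graph without
the higher vertices (`prod_uncovered`). Splitting matchings by the partner of the vertex gives `x =
1 / (1 + γ ∑ x_u)`, where the `x_u` live in the graph with that vertex removed as well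
(`uncovered_recurrence`). Unfolding this gives a recursion along the tree of self-avoiding walks,
which the algorithm cuts off at a depth `l`.

The truncation error has to be weighed against the number of self-avoiding walks, not against the
maximum degree. In the coordinate `y = log (2 / x - 1)` the recurrence reads `y = log (1 + 2γ ∑
x_u)`, and for every `p = q + 1` the `p`-th power of the error at a node is at most `4γ / p²` times
the sum of the `p`-th powers of the errors at its children (`message_contraction`). As this is a sum
and not a maximum, iterating it gives `(4γ / p²) ^ l` times the number of walks of length `l`, hence
`(4γΔ / p²) ^ l` up to a factor (`truncation_error`). If `p² ≥ 8γΔ`, this is at most `2 ^ (-l)`.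
Extracting the `p`-th root costs a factor `p` in the depth: `l` of order `p log (n / ε)` suffices
(`message_error_le`), plus a multiple of `log (n / ε)` that makes the walk bound applicable. With
`p` of order `1 + √(γΔ)`, the tree has `O(Δ ^ l)` nodes, which is the stated exponent.

On the machine, the activity is rounded to `⌊γN⌋ / N` and a depth-first search evaluates the
truncated recursion exactly, in unreduced integer fractions. Their bit lengths are linear in the
number of nodes for a fixed activity (`treeValue_le`), so the running time is polynomial in the
input size and the tree size. Only the coefficient of the logarithm in the depth reaches the
exponent, and it is controlled by `√(γΔ)` and `a`; all other dependence on `γ`, `Δ`, `c` goes into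
`C`. -/

theorem mul_pow_le_one_add_pow {u : ℝ} (hu : 0 ≤ u) (q : ℕ) :
    ((q + 1 : ℕ) : ℝ) * u ^ q ≤ (1 + u) ^ (q + 1) := by
  induction q with
  | zero => simp [hu]
  | succ q ih =>
    have h1 : u ^ (q + 1) ≤ (1 + u) ^ (q + 1) := pow_le_pow_left₀ hu (by linarith) _
    have h2 : u * (((q + 1 : ℕ) : ℝ) * u ^ q) ≤ u * (1 + u) ^ (q + 1) :=
      mul_le_mul_of_nonneg_left ih hu
    calc ((q + 1 + 1 : ℕ) : ℝ) * u ^ (q + 1)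
        = u * (((q + 1 : ℕ) : ℝ) * u ^ q) + u ^ (q + 1) := by push_cast; ring
      _ ≤ u * (1 + u) ^ (q + 1) + (1 + u) ^ (q + 1) := add_le_add h2 h1
      _ = (1 + u) ^ (q + 1 + 1) := by ring

/-- The left side is the probability of exactly one success in `q + 1` trials. Formally,
`mul_pow_le_one_add_pow`, which keeps one term of the binomial expansion, is applied with `u = (1 -
z) / z`. -/
theorem mul_one_sub_pow_le {z : ℝ} (h0 : 0 ≤ z) (h1 : z ≤ 1) (q : ℕ) :
    ((q + 1 : ℕ) : ℝ) * (z * (1 - z) ^ q) ≤ 1 := by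
  rcases h0.eq_or_lt with rfl | hz
  · simp
  have hu : 0 ≤ (1 - z) / z := div_nonneg (by linarith) hz.le
  have h := mul_pow_le_one_add_pow hu q
  have e : 1 + (1 - z) / z = 1 / z := by field_simp; ring
  rw [e, div_pow, div_pow, one_pow, pow_succ z q] at h
  rw [← mul_div_assoc, div_le_div_iff₀ (by positivity) (by positivity)] at h
  have hzq : 0 < z ^ q := by positivity
  have : z ^ q * (((q + 1 : ℕ) : ℝ) * (z * (1 - z) ^ q)) ≤ z ^ q * 1 := by linarith
  exact le_of_mul_le_mul_left this hzq

/-- The power mean inequality with unnormalized weights. -/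
theorem sum_mul_pow_le {ι : Type*} (s : Finset ι) (w z : ι → ℝ) (hw : ∀ i ∈ s, 0 < w i)
    (hz : ∀ i ∈ s, 0 ≤ z i) (q : ℕ) :
    (∑ i ∈ s, w i * z i) ^ (q + 1) ≤ (∑ i ∈ s, w i) ^ q * ∑ i ∈ s, w i * z i ^ (q + 1) := by
  rcases s.eq_empty_or_nonempty with rfl | hs
  · simp
  have hS : 0 < ∑ i ∈ s, w i := Finset.sum_pos hw hs
  set S := ∑ i ∈ s, w i
  have h := Real.pow_arith_mean_le_arith_mean_pow s (fun i => w i / S) z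
    (fun i hi => (div_pos (hw i hi) hS).le) (by rw [← Finset.sum_div]; exact div_self hS.ne') hz
    (q + 1)
  have e1 : ∑ i ∈ s, w i / S * z i = (∑ i ∈ s, w i * z i) / S := by
    rw [Finset.sum_div]; exact Finset.sum_congr rfl fun i _ => by ring
  have e2 : ∑ i ∈ s, w i / S * z i ^ (q + 1) = (∑ i ∈ s, w i * z i ^ (q + 1)) / S := by
    rw [Finset.sum_div]; exact Finset.sum_congr rfl fun i _ => by ring
  rw [e1, e2, div_pow, div_le_div_iff₀ (by positivity) hS] at h
  have : S * (∑ i ∈ s, w i * z i) ^ (q + 1) ≤ S * (S ^ q * ∑ i ∈ s, w i * z i ^ (q + 1)) := by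
    calc _ = (∑ i ∈ s, w i * z i) ^ (q + 1) * S := by ring
      _ ≤ _ := h
      _ = _ := by ring
  exact le_of_mul_le_mul_left this hS

/-- The base on the left bounds the derivative of the recurrence in message coordinates along a
direction `e`. The power mean inequality with weights `x i` produces `S ^ q`; the maximum of `x (2 -
x) ^ (q + 1)` gives one factor `1 / (q + 1)`, and absorbing `(2γS) ^ q` into `(1 + 2γS) ^ (q + 1)`
gives the other. Neither `S` nor the number of children survives. -/
theorem derivative_bound {ι : Type*} (s : Finset ι) (x e : ι → ℝ) {γ : ℝ} (hγ : 0 ≤ γ)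
    (hx : ∀ i ∈ s, 0 < x i) (hx2 : ∀ i ∈ s, x i ≤ 2) (he : ∀ i ∈ s, 0 ≤ e i) (q : ℕ) :
    (γ * (∑ i ∈ s, x i * (2 - x i) * e i) / (1 + 2 * γ * ∑ i ∈ s, x i)) ^ (q + 1) ≤
      4 * γ / ((q + 1 : ℕ) : ℝ) ^ 2 * ∑ i ∈ s, e i ^ (q + 1) := by
  set S := ∑ i ∈ s, x i with hS
  have hS0 : 0 ≤ S := Finset.sum_nonneg fun i hi => (hx i hi).le
  have hq : (0 : ℝ) < ((q + 1 : ℕ) : ℝ) := by positivity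
  have hE : 0 ≤ ∑ i ∈ s, e i ^ (q + 1) := Finset.sum_nonneg fun i hi => pow_nonneg (he i hi) _
  have h1 : (∑ i ∈ s, x i * (2 - x i) * e i) ^ (q + 1) ≤
      S ^ q * ∑ i ∈ s, x i * ((2 - x i) * e i) ^ (q + 1) := by
    have := sum_mul_pow_le s x (fun i => (2 - x i) * e i) hx
      (fun i hi => mul_nonneg (by linarith [hx2 i hi]) (he i hi)) q
    simpa [mul_assoc] using this
  have h2 : ∑ i ∈ s, x i * ((2 - x i) * e i) ^ (q + 1) ≤
      2 ^ (q + 2) / ((q + 1 : ℕ) : ℝ) * ∑ i ∈ s, e i ^ (q + 1) := by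
    rw [Finset.mul_sum]
    refine Finset.sum_le_sum fun i hi => ?_
    have h := mul_one_sub_pow_le (z := x i / 2) (by linarith [hx i hi]) (by linarith [hx2 i hi])
      (q + 1)
    have e1 : x i * ((2 - x i) * e i) ^ (q + 1) =
        2 ^ (q + 2) * (x i / 2 * (1 - x i / 2) ^ (q + 1)) * e i ^ (q + 1) := by
      have : (2 - x i) = 2 * (1 - x i / 2) := by ring
      rw [this, mul_pow, mul_pow]; ring
    rw [e1]
    refine mul_le_mul_of_nonneg_right ?_ (pow_nonneg (he i hi) _)
    rw [le_div_iff₀ hq]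
    have h0 : 0 ≤ x i / 2 * (1 - x i / 2) ^ (q + 1) :=
      mul_nonneg (by linarith [hx i hi]) (pow_nonneg (by linarith [hx2 i hi]) _)
    have h' : ((q + 1 : ℕ) : ℝ) * (x i / 2 * (1 - x i / 2) ^ (q + 1)) ≤ 1 := by
      refine le_trans (mul_le_mul_of_nonneg_right ?_ h0) h
      push_cast; linarith
    calc _ = 2 ^ (q + 2) * (((q + 1 : ℕ) : ℝ) * (x i / 2 * (1 - x i / 2) ^ (q + 1))) := by ring
      _ ≤ 2 ^ (q + 2) * 1 := mul_le_mul_of_nonneg_left h' (by positivity)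
      _ = _ := by ring
  have h3 := mul_pow_le_one_add_pow (u := 2 * γ * S) (by positivity) q
  have hden : 0 < (1 + 2 * γ * S) ^ (q + 1) := by positivity
  rw [div_pow, div_le_iff₀ hden, mul_pow]
  calc γ ^ (q + 1) * (∑ i ∈ s, x i * (2 - x i) * e i) ^ (q + 1)
      ≤ γ ^ (q + 1) * (S ^ q * (2 ^ (q + 2) / ((q + 1 : ℕ) : ℝ) * ∑ i ∈ s, e i ^ (q + 1))) := by
        gcongr
        exact h1.trans (mul_le_mul_of_nonneg_left h2 (by positivity))
    _ = 4 * γ / ((q + 1 : ℕ) : ℝ) ^ 2 * (∑ i ∈ s, e i ^ (q + 1)) *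
          (((q + 1 : ℕ) : ℝ) * (2 * γ * S) ^ q) := by
        rw [mul_pow, mul_pow]; field_simp; ring
    _ ≤ 4 * γ / ((q + 1 : ℕ) : ℝ) ^ 2 * (∑ i ∈ s, e i ^ (q + 1)) * (1 + 2 * γ * S) ^ (q + 1) :=
        mul_le_mul_of_nonneg_left h3 (by positivity)

/-- The inverse of the coordinate `x ↦ log (2 / x - 1)`. -/
noncomputable def ofMessage (y : ℝ) : ℝ := 2 / (1 + Real.exp y)

theorem ofMessage_pos (y : ℝ) : 0 < ofMessage y := by unfold ofMessage; positivity

theorem ofMessage_le (y : ℝ) : ofMessage y ≤ 2 := by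
  unfold ofMessage
  rw [div_le_iff₀ (by positivity)]
  nlinarith [Real.exp_pos y]

theorem hasDerivAt_ofMessage (y : ℝ) :
    HasDerivAt ofMessage (-(ofMessage y * (2 - ofMessage y) / 2)) y := by
  have h : HasDerivAt (fun y => 1 + Real.exp y) (Real.exp y) y :=
    (Real.hasDerivAt_exp y).const_add 1
  have hne : 1 + Real.exp y ≠ 0 := by positivity
  have := (hasDerivAt_const y (2 : ℝ)).div h hne
  refine this.congr_deriv ?_
  unfold ofMessage; field_simp; ring

/-- Mean value inequality along the segment from `y` to `y'`: the bound of `derivative_bound`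
depends on the direction `|y' - y|` only, so it holds uniformly along the segment. -/
theorem log_contraction {ι : Type*} (s : Finset ι) (y y' : ι → ℝ) {γ : ℝ} (hγ : 0 ≤ γ) (q : ℕ) :
    |Real.log (1 + 2 * γ * ∑ i ∈ s, ofMessage (y' i)) -
        Real.log (1 + 2 * γ * ∑ i ∈ s, ofMessage (y i))| ^ (q + 1) ≤
      4 * γ / ((q + 1 : ℕ) : ℝ) ^ 2 * ∑ i ∈ s, |y' i - y i| ^ (q + 1) := by
  set R := 4 * γ / ((q + 1 : ℕ) : ℝ) ^ 2 * ∑ i ∈ s, |y' i - y i| ^ (q + 1) with hR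
  have hR0 : 0 ≤ R := by positivity
  -- The `(q + 1)`-th root of the target, so that a bound on a power becomes a bound on the
  -- derivative.
  set C := R ^ ((1 : ℝ) / ((q + 1 : ℕ) : ℝ)) with hC
  have hC0 : 0 ≤ C := by positivity
  have hCR : C ^ (q + 1) = R := by
    rw [hC, one_div]; exact Real.rpow_inv_natCast_pow hR0 (by omega)
  set Y : ι → ℝ → ℝ := fun i t => y i + t * (y' i - y i) with hY
  set F : ℝ → ℝ := fun t => Real.log (1 + 2 * γ * ∑ i ∈ s, ofMessage (Y i t)) with hF
  set D : ℝ → ℝ := fun t => (2 * γ * ∑ i ∈ s,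
    (-(ofMessage (Y i t) * (2 - ofMessage (Y i t)) / 2)) * (y' i - y i)) /
      (1 + 2 * γ * ∑ i ∈ s, ofMessage (Y i t)) with hD
  have hpos : ∀ t, 0 < 1 + 2 * γ * ∑ i ∈ s, ofMessage (Y i t) := fun t => by
    have : 0 ≤ ∑ i ∈ s, ofMessage (Y i t) := Finset.sum_nonneg fun i _ => (ofMessage_pos _).le
    positivity
  have hder : ∀ t, HasDerivAt F (D t) t := fun t => by
    have hYd : ∀ i, HasDerivAt (Y i) (y' i - y i) t := fun i => by
      exact (((hasDerivAt_id t).mul_const (y' i - y i)).const_add (y i)).congr_deriv (one_mul _)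
    have hs : HasDerivAt (fun t => ∑ i ∈ s, ofMessage (Y i t)) (∑ i ∈ s,
        (-(ofMessage (Y i t) * (2 - ofMessage (Y i t)) / 2)) * (y' i - y i)) t :=
      HasDerivAt.fun_sum fun i _ => (hasDerivAt_ofMessage (Y i t)).comp t (hYd i)
    exact ((hs.const_mul (2 * γ)).const_add 1).log (hpos t).ne'
  have hbd : ∀ t, ‖D t‖ ≤ C := fun t => by
    have h := derivative_bound s (fun i => ofMessage (Y i t)) (fun i => |y' i - y i|) hγ
      (fun i _ => ofMessage_pos _) (fun i _ => ofMessage_le _) (fun i _ => abs_nonneg _) q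
    rw [← hR, ← hCR] at h
    have h' := le_of_pow_le_pow_left₀ (by omega) hC0 h
    refine le_trans ?_ h'
    rw [Real.norm_eq_abs, hD]
    dsimp only
    rw [abs_div, abs_of_pos (hpos t)]
    refine div_le_div_of_nonneg_right ?_ (hpos t).le
    rw [abs_mul, abs_of_nonneg (by positivity : 0 ≤ 2 * γ), mul_comm 2 γ, mul_assoc]
    refine mul_le_mul_of_nonneg_left ?_ hγ
    calc 2 * |∑ i ∈ s, (-(ofMessage (Y i t) * (2 - ofMessage (Y i t)) / 2)) * (y' i - y i)|
        ≤ 2 * ∑ i ∈ s, |(-(ofMessage (Y i t) * (2 - ofMessage (Y i t)) / 2)) * (y' i - y i)| := by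
          gcongr; exact Finset.abs_sum_le_sum_abs _ _
      _ = _ := by
          rw [Finset.mul_sum]
          refine Finset.sum_congr rfl fun i _ => ?_
          have h1 := ofMessage_pos (Y i t)
          have h2 := ofMessage_le (Y i t)
          rw [abs_mul, abs_neg, abs_of_nonneg
            (div_nonneg (mul_nonneg h1.le (by linarith)) (by norm_num))]
          ring
  have h := norm_image_sub_le_of_norm_deriv_le_segment_01' (f := F) (f' := D) (C := C)
    (fun t _ => (hder t).hasDerivWithinAt) (fun t _ => hbd t)
  have e1 : F 1 = Real.log (1 + 2 * γ * ∑ i ∈ s, ofMessage (y' i)) := by simp [hF, hY]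
  have e0 : F 0 = Real.log (1 + 2 * γ * ∑ i ∈ s, ofMessage (y i)) := by simp [hF, hY]
  rw [← e1, ← e0, ← hCR]
  exact pow_le_pow_left₀ (abs_nonneg _) h _

/-- The coordinate in which the monomer-dimer recurrence contracts. -/
noncomputable def message (x : ℝ) : ℝ := Real.log (2 / x - 1)

theorem ofMessage_message {x : ℝ} (h0 : 0 < x) (h2 : x < 2) : ofMessage (message x) = x := by
  have : 0 < 2 / x - 1 := by
    rw [sub_pos, lt_div_iff₀ h0]; linarith
  rw [ofMessage, message, Real.exp_log this]
  field_simp; ring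

theorem message_recurrence {γ S : ℝ} (h : 0 < 1 + γ * S) :
    message (1 / (1 + γ * S)) = Real.log (1 + 2 * γ * S) := by
  have hne := h.ne'
  rw [message]; congr 1; field_simp; ring

/-- One step of the recurrence, in the message coordinate. -/
theorem message_contraction {ι : Type*} (s : Finset ι) (x x' : ι → ℝ) {γ : ℝ} (hγ : 0 ≤ γ)
    (hx : ∀ i ∈ s, 0 < x i ∧ x i ≤ 1) (hx' : ∀ i ∈ s, 0 < x' i ∧ x' i ≤ 1) (q : ℕ) :
    |message (1 / (1 + γ * ∑ i ∈ s, x' i)) - message (1 / (1 + γ * ∑ i ∈ s, x i))| ^ (q + 1) ≤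
      4 * γ / ((q + 1 : ℕ) : ℝ) ^ 2 * ∑ i ∈ s, |message (x' i) - message (x i)| ^ (q + 1) := by
  have h1 : 0 ≤ ∑ i ∈ s, x i := Finset.sum_nonneg fun i hi => (hx i hi).1.le
  have h2 : 0 ≤ ∑ i ∈ s, x' i := Finset.sum_nonneg fun i hi => (hx' i hi).1.le
  rw [message_recurrence (by positivity), message_recurrence (by positivity)]
  have h := log_contraction s (fun i => message (x i)) (fun i => message (x' i)) hγ q
  rwa [Finset.sum_congr rfl fun i hi => ofMessage_message (hx i hi).1
      (by linarith [(hx i hi).2]),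
    Finset.sum_congr rfl fun i hi => ofMessage_message (hx' i hi).1
      (by linarith [(hx' i hi).2])] at h

theorem exp_message {x : ℝ} (h0 : 0 < x) (h1 : x ≤ 1) : Real.exp (message x) = 2 / x - 1 := by
  rw [message, Real.exp_log]
  rw [sub_pos, lt_div_iff₀ h0]; linarith

/-- Closeness of messages is closeness of the values up to a factor. -/
theorem le_exp_mul_of_message {x x' δ : ℝ} (h0 : 0 < x) (h1 : x ≤ 1) (h0' : 0 < x')
    (h1' : x' ≤ 1) (hδ : |message x - message x'| ≤ δ) : 1 / x ≤ Real.exp δ * (1 / x') := by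
  have h := (abs_le.1 hδ).2
  have h2 : Real.exp (message x) ≤ Real.exp (δ + message x') := Real.exp_le_exp.2 (by linarith)
  rw [Real.exp_add, exp_message h0 h1, exp_message h0' h1'] at h2
  have hd : 1 ≤ Real.exp δ := Real.one_le_exp ((abs_nonneg _).trans hδ)
  have e : ∀ z : ℝ, 2 / z = 2 * (1 / z) := fun z => by ring
  rw [e, e] at h2
  -- Here `2 / x - 1 ≤ exp δ * (2 / x' - 1)`, and the leftover `1 - exp δ` is nonpositive.
  nlinarith

/-! ### The recurrence for the partition function -/

section Recurrence

variable {V : Type*} [Fintype V] [DecidableEq V]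

open Classical in
/-- The matchings of `G` that cover no vertex of `X`. -/
noncomputable def matchingsAvoiding (G : SimpleGraph V) (X : Finset V) :
    Finset (Finset (Sym2 V)) :=
  {M | IsMatchingSet G M ∧ ∀ e ∈ M, ∀ v ∈ e, v ∉ X}

/-- The partition function of `G` with the vertices of `X` removed. -/
noncomputable def avoidingZ (γ : ℝ) (G : SimpleGraph V) (X : Finset V) : ℝ :=
  ∑ M ∈ matchingsAvoiding G X, γ ^ M.card

open Classical in
/-- The neighbours of `v` outside `X`. -/
noncomputable def succs (G : SimpleGraph V) (X : Finset V) (v : V) : Finset V :=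
  {u | G.Adj v u ∧ u ∉ X}

theorem mem_succs {G : SimpleGraph V} {X : Finset V} {u v : V} :
    u ∈ succs G X v ↔ G.Adj v u ∧ u ∉ X := by simp [succs]

theorem mem_matchingsAvoiding {G : SimpleGraph V} {X : Finset V} {M : Finset (Sym2 V)} :
    M ∈ matchingsAvoiding G X ↔ IsMatchingSet G M ∧ ∀ e ∈ M, ∀ v ∈ e, v ∉ X := by
  simp [matchingsAvoiding]

theorem avoidingZ_empty (γ : ℝ) (G : SimpleGraph V) :
    avoidingZ γ G ∅ = partitionFunction γ G := by
  unfold avoidingZ partitionFunction matchingsAvoiding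
  congr 1; ext M; simp

theorem empty_mem_matchingsAvoiding (G : SimpleGraph V) (X : Finset V) :
    ∅ ∈ matchingsAvoiding G X := by
  simp [mem_matchingsAvoiding, IsMatchingSet]

theorem avoidingZ_univ (γ : ℝ) (G : SimpleGraph V) : avoidingZ γ G univ = 1 := by
  have : matchingsAvoiding G univ = {∅} := by
    ext M
    rw [mem_matchingsAvoiding, mem_singleton]
    refine ⟨fun h => ?_, fun h => by simp [h, IsMatchingSet]⟩
    refine Finset.eq_empty_of_forall_notMem fun e he => ?_
    induction e using Sym2.ind with
    | _ a b => exact h.2 _ he a (by simp) (mem_univ _)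
  simp [avoidingZ, this]

theorem avoidingZ_pos {γ : ℝ} (hγ : 0 ≤ γ) (G : SimpleGraph V) (X : Finset V) :
    0 < avoidingZ γ G X := by
  refine Finset.sum_pos' (fun M _ => by positivity) ⟨∅, empty_mem_matchingsAvoiding G X, by simp⟩

/-- Deleting the edge `vu` is a bijection onto the matchings that avoid both endpoints as well. -/
theorem sum_matchings_through (γ : ℝ) (G : SimpleGraph V) {X : Finset V} {u v : V} (hv : v ∉ X)
    (hu : u ∈ succs G X v) :
    ∑ M ∈ matchingsAvoiding G X with s(v, u) ∈ M, γ ^ M.card =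
      γ * avoidingZ γ G (insert u (insert v X)) := by
  rw [mem_succs] at hu
  rw [avoidingZ, Finset.mul_sum]
  refine Finset.sum_bij' (fun M _ => M.erase s(v, u)) (fun M _ => insert s(v, u) M) ?_ ?_ ?_ ?_ ?_
  · intro M hM
    simp only [mem_filter, mem_matchingsAvoiding] at hM
    obtain ⟨⟨⟨h1, h2⟩, h3⟩, h4⟩ := hM
    rw [mem_matchingsAvoiding]
    refine ⟨⟨fun e he => h1 e (mem_of_mem_erase he), fun e he e' he' =>
      h2 e (mem_of_mem_erase he) e' (mem_of_mem_erase he')⟩, fun e he w hw => ?_⟩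
    have hne := ne_of_mem_erase he
    have hd := h2 e (mem_of_mem_erase he) _ h4 hne
    simp only [mem_insert, not_or]
    refine ⟨?_, ?_, h3 e (mem_of_mem_erase he) w hw⟩
    · rintro rfl; exact hd w ⟨hw, by simp⟩
    · rintro rfl; exact hd w ⟨hw, by simp⟩
  · intro M hM
    rw [mem_matchingsAvoiding] at hM
    obtain ⟨⟨h1, h2⟩, h3⟩ := hM
    simp only [mem_filter, mem_matchingsAvoiding, mem_insert_self, and_true]
    have hdis : ∀ e ∈ M, ∀ w, ¬ (w ∈ e ∧ w ∈ s(v, u)) := by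
      rintro e he w ⟨hw, hw'⟩
      have := h3 e he w hw
      rw [Sym2.mem_iff] at hw'
      rcases hw' with rfl | rfl <;> simp at this
    refine ⟨⟨fun e he => ?_, fun e he e' he' hne w hw => ?_⟩, fun e he w hw => ?_⟩
    · rcases mem_insert.1 he with rfl | he
      · exact hu.1
      · exact h1 e he
    · rcases mem_insert.1 he with rfl | he <;> rcases mem_insert.1 he' with rfl | he'
      · exact hne rfl
      · exact hdis e' he' w hw.symm
      · exact hdis e he w hw
      · exact h2 e he e' he' hne w hw
    · rcases mem_insert.1 he with rfl | he
      · rw [Sym2.mem_iff] at hw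
        rcases hw with rfl | rfl
        · exact hv
        · exact hu.2
      · have := h3 e he w hw
        simp only [mem_insert, not_or] at this
        exact this.2.2
  · intro M hM
    exact insert_erase (mem_filter.1 hM).2
  · intro M hM
    rw [mem_matchingsAvoiding] at hM
    refine erase_insert fun h => ?_
    exact hM.2 _ h u (by simp) (by simp)
  · intro M hM
    rw [← pow_succ', card_erase_add_one (mem_filter.1 hM).2]

/-- Either `v` is uncovered, or it is matched to exactly one neighbour `u`; the matchings of the
second kind are partitioned by `u`. -/
theorem avoidingZ_recurrence (γ : ℝ) (G : SimpleGraph V) {X : Finset V} {v : V} (hv : v ∉ X) :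
    avoidingZ γ G X = avoidingZ γ G (insert v X) +
      γ * ∑ u ∈ succs G X v, avoidingZ γ G (insert u (insert v X)) := by
  classical
  rw [avoidingZ, ← Finset.sum_filter_not_add_sum_filter _ (fun M => ∃ e ∈ M, v ∈ e)]
  congr 1
  · rw [avoidingZ]
    congr 1
    ext M
    simp only [mem_filter, mem_matchingsAvoiding, mem_insert, not_or, not_exists, not_and]
    constructor
    · rintro ⟨⟨h1, h2⟩, h3⟩
      exact ⟨h1, fun e he w hw => ⟨fun h => h3 e he (h ▸ hw), h2 e he w hw⟩⟩
    · rintro ⟨h1, h2⟩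
      exact ⟨⟨h1, fun e he w hw => (h2 e he w hw).2⟩, fun e he hw => (h2 e he v hw).1 rfl⟩
  · rw [Finset.mul_sum, ← Finset.sum_congr rfl fun u hu => sum_matchings_through γ G hv hu,
      ← Finset.sum_biUnion]
    · congr 1
      ext M
      simp only [mem_filter, mem_biUnion]
      constructor
      · rintro ⟨hM, e, he, hve⟩
        obtain ⟨u, rfl⟩ := Sym2.mem_iff_exists.1 hve
        rw [mem_matchingsAvoiding] at hM
        refine ⟨u, mem_succs.2 ⟨hM.1.1 _ he, hM.2 _ he u (by simp)⟩,
          mem_matchingsAvoiding.2 hM, he⟩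
      · rintro ⟨u, -, hM, he⟩
        exact ⟨hM, _, he, by simp⟩
    · intro u hu u' hu' hne
      rw [Function.onFun, Finset.disjoint_left]
      intro M hM hM'
      simp only [mem_filter, mem_matchingsAvoiding] at hM hM'
      refine hM.1.1.2 _ hM.2 _ hM'.2 (fun h => hne ?_) v ⟨by simp, by simp⟩
      exact Sym2.congr_right.1 h

/-- The probability that `v` is not covered, in `G` with `X` removed except for `v`. -/
noncomputable def uncovered (γ : ℝ) (G : SimpleGraph V) (X : Finset V) (v : V) : ℝ :=
  avoidingZ γ G X / avoidingZ γ G (X.erase v)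

theorem uncovered_pos {γ : ℝ} (hγ : 0 ≤ γ) (G : SimpleGraph V) (X : Finset V) (v : V) :
    0 < uncovered γ G X v :=
  div_pos (avoidingZ_pos hγ G X) (avoidingZ_pos hγ G _)

/-- This is `avoidingZ_recurrence` for `X.erase v`, divided by the weight of `X`. All siblings are
taken relative to the same `X`, so no ordering of the neighbours enters and the branches are exactly
the self-avoiding walks. -/
theorem uncovered_recurrence {γ : ℝ} (hγ : 0 ≤ γ) (G : SimpleGraph V) {X : Finset V} {v : V}
    (hv : v ∈ X) :
    uncovered γ G X v = 1 / (1 + γ * ∑ u ∈ succs G X v, uncovered γ G (insert u X) u) := by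
  have h := avoidingZ_recurrence γ G (notMem_erase v X)
  rw [insert_erase hv] at h
  -- A vertex is not its own neighbour, so it does not matter whether `v` belongs to `X`.
  have hs : succs G (X.erase v) v = succs G X v := by
    ext u
    simp only [mem_succs, mem_erase, not_and]
    refine and_congr_right fun hadj => ⟨fun h => h hadj.ne', fun h _ => h⟩
  have hsum : ∑ u ∈ succs G X v, uncovered γ G (insert u X) u =
      (∑ u ∈ succs G X v, avoidingZ γ G (insert u X)) / avoidingZ γ G X := by
    rw [Finset.sum_div]
    refine Finset.sum_congr rfl fun u hu => ?_
    rw [uncovered, erase_insert (mem_succs.1 hu).2]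
  have hX := avoidingZ_pos hγ G X
  rw [hsum, uncovered, h, hs]
  field_simp

theorem uncovered_le_one {γ : ℝ} (hγ : 0 ≤ γ) (G : SimpleGraph V) {X : Finset V} {v : V}
    (hv : v ∈ X) : uncovered γ G X v ≤ 1 := by
  rw [uncovered_recurrence hγ G hv]
  have : 0 ≤ ∑ u ∈ succs G X v, uncovered γ G (insert u X) u :=
    Finset.sum_nonneg fun u _ => (uncovered_pos hγ G _ u).le
  rw [div_le_one (by positivity)]
  have := mul_nonneg hγ this
  linarith

/-! ### The truncated recurrence and its error -/

/-- The recurrence for `uncovered`, truncated at depth `r`. -/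
noncomputable def truncated (γ : ℝ) (G : SimpleGraph V) : ℕ → Finset V → V → ℝ
  | 0, _, _ => 1
  | r + 1, X, v => 1 / (1 + γ * ∑ u ∈ succs G X v, truncated γ G r (insert u X) u)

/-- The number of self-avoiding walks of length `r` from `v` that do not return to `X`. -/
noncomputable def sawCount (G : SimpleGraph V) : ℕ → Finset V → V → ℕ
  | 0, _, _ => 1
  | r + 1, X, v => ∑ u ∈ succs G X v, sawCount G r (insert u X) u

theorem truncated_pos {γ : ℝ} (hγ : 0 ≤ γ) (G : SimpleGraph V) (r : ℕ) (X : Finset V) (v : V) :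
    0 < truncated γ G r X v := by
  induction r generalizing X v with
  | zero => simp [truncated]
  | succ r ih =>
    rw [truncated]
    have : 0 ≤ ∑ u ∈ succs G X v, truncated γ G r (insert u X) u :=
      Finset.sum_nonneg fun u _ => (ih _ u).le
    positivity

theorem truncated_le_one {γ : ℝ} (hγ : 0 ≤ γ) (G : SimpleGraph V) (r : ℕ) (X : Finset V)
    (v : V) : truncated γ G r X v ≤ 1 := by
  cases r with
  | zero => simp [truncated]
  | succ r =>
    rw [truncated]
    have : 0 ≤ ∑ u ∈ succs G X v, truncated γ G r (insert u X) u :=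
      Finset.sum_nonneg fun u _ => (truncated_pos hγ G r _ u).le
    rw [div_le_one (by positivity)]
    have := mul_nonneg hγ this
    linarith

/-- The error made at a leaf of the truncated tree: the message is `log (1 + 2γS)` with `S` a sum of
at most `|V|` probabilities. -/
theorem abs_message_uncovered_le {γ : ℝ} (hγ : 0 ≤ γ) (G : SimpleGraph V) {X : Finset V} {v : V}
    (hv : v ∈ X) : |message (uncovered γ G X v)| ≤ 2 * γ * Fintype.card V := by
  have h0 : 0 ≤ ∑ u ∈ succs G X v, uncovered γ G (insert u X) u :=
    Finset.sum_nonneg fun u _ => (uncovered_pos hγ G _ u).le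
  have h1 : ∑ u ∈ succs G X v, uncovered γ G (insert u X) u ≤ Fintype.card V := by
    calc _ ≤ ∑ u ∈ succs G X v, (1 : ℝ) :=
          Finset.sum_le_sum fun u _ => uncovered_le_one hγ G (mem_insert_self u X)
      _ = (succs G X v).card := by simp
      _ ≤ _ := by exact_mod_cast Finset.card_le_univ _
  rw [uncovered_recurrence hγ G hv, message_recurrence (by positivity)]
  set S := ∑ u ∈ succs G X v, uncovered γ G (insert u X) u
  have hS : 0 ≤ 2 * γ * S := by positivity
  rw [abs_of_nonneg (Real.log_nonneg (by linarith))]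
  calc Real.log (1 + 2 * γ * S) ≤ (1 + 2 * γ * S) - 1 :=
        Real.log_le_sub_one_of_pos (by linarith)
    _ = 2 * γ * S := by ring
    _ ≤ _ := by gcongr

/-- The contraction is iterated down the tree. Each of the `sawCount` leaves at depth `r`
contributes its initial error, with one factor `4γ / (q + 1)²` per level. -/
theorem truncation_error {γ : ℝ} (hγ : 0 ≤ γ) (G : SimpleGraph V) (q r : ℕ) {X : Finset V}
    {v : V} (hv : v ∈ X) :
    |message (uncovered γ G X v) - message (truncated γ G r X v)| ^ (q + 1) ≤
      (4 * γ / ((q + 1 : ℕ) : ℝ) ^ 2) ^ r * sawCount G r X v *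
        (2 * γ * Fintype.card V) ^ (q + 1) := by
  induction r generalizing X v with
  | zero =>
    -- The default leaf value `1` has message `0`, so the leaf error is the size of the true
    -- message.
    have : message 1 = 0 := by norm_num [message]
    simp only [truncated, sawCount, this, sub_zero, pow_zero, Nat.cast_one, one_mul]
    exact pow_le_pow_left₀ (abs_nonneg _) (abs_message_uncovered_le hγ G hv) _
  | succ r ih =>
    rw [uncovered_recurrence hγ G hv, truncated]
    refine (message_contraction _ _ _ hγ
      (fun u _ => ⟨truncated_pos hγ G r _ u, truncated_le_one hγ G r _ u⟩)
      (fun u _ => ⟨uncovered_pos hγ G _ u, uncovered_le_one hγ G (mem_insert_self u X)⟩) q).trans ?_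
    calc _ ≤ 4 * γ / ((q + 1 : ℕ) : ℝ) ^ 2 * ∑ u ∈ succs G X v,
            (4 * γ / ((q + 1 : ℕ) : ℝ) ^ 2) ^ r * sawCount G r (insert u X) u *
              (2 * γ * Fintype.card V) ^ (q + 1) :=
          mul_le_mul_of_nonneg_left
            (Finset.sum_le_sum fun u _ => ih (mem_insert_self u X)) (by positivity)
      _ = _ := by
          rw [sawCount, ← Finset.sum_mul, ← Finset.mul_sum]; push_cast; ring

end Recurrence

/-! ### Counting self-avoiding walks -/

theorem finite_paths {V : Type*} [Fintype V] (G : SimpleGraph V) (l : ℕ) (X : Finset V)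
    (v w : V) :
    {p : G.Walk v w | (p.IsPath ∧ p.length = l) ∧ ∀ x ∈ p.support.tail, x ∉ X}.Finite := by
  classical
  exact (Set.toFinite {p : G.Walk v w | p.length = l}).subset fun p hp => hp.1.2

/-- Prepending `v` maps the walks of the children injectively to walks from `v`. Requiring the walk
to avoid `X` after its start makes the induction close, since it keeps `v` itself from recurring. -/
theorem sawCount_le_sum {V : Type*} [Fintype V] [DecidableEq V] (G : SimpleGraph V) (l : ℕ)
    {X : Finset V} {v : V} (hv : v ∈ X) :
    sawCount G l X v ≤ ∑ w : V, Set.ncard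
      {p : G.Walk v w | (p.IsPath ∧ p.length = l) ∧ ∀ x ∈ p.support.tail, x ∉ X} := by
  classical
  induction l generalizing X v with
  | zero =>
    rw [sawCount]
    refine le_trans ?_ (Finset.single_le_sum (f := fun w => Set.ncard
      {p : G.Walk v w | (p.IsPath ∧ p.length = 0) ∧ ∀ x ∈ p.support.tail, x ∉ X})
      (fun _ _ => Nat.zero_le _) (mem_univ v))
    rw [Nat.one_le_iff_ne_zero, ← Nat.pos_iff_ne_zero, Set.ncard_pos (finite_paths G 0 X v v)]
    exact ⟨SimpleGraph.Walk.nil, by simp⟩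
  | succ l ih =>
    rw [sawCount]
    refine (Finset.sum_le_sum fun u _ => ih (mem_insert_self u X)).trans ?_
    rw [Finset.sum_comm]
    refine Finset.sum_le_sum fun w _ => ?_
    simp only [Set.ncard_eq_toFinset_card _ (finite_paths G _ _ _ w)]
    rw [← Finset.card_sigma]
    refine Finset.card_le_card_of_forall_subsingleton
      (fun a p => ∃ h : G.Adj v a.1, p = SimpleGraph.Walk.cons h a.2) ?_ ?_
    · rintro ⟨u, p⟩ hp
      simp only [mem_sigma, Set.Finite.mem_toFinset, Set.mem_ofPred_eq, mem_succs, mem_insert,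
        not_or] at hp
      obtain ⟨⟨hadj, hu⟩, ⟨hpath, hlen⟩, hav⟩ := hp
      refine ⟨SimpleGraph.Walk.cons hadj p, ?_, hadj, rfl⟩
      have hsup : ∀ x ∈ p.support, x ∉ X := by
        intro x hx
        rw [← SimpleGraph.Walk.cons_tail_support, List.mem_cons] at hx
        rcases hx with rfl | hx
        · exact hu
        · exact (hav x hx).2
      simp only [Set.Finite.mem_toFinset, Set.mem_ofPred_eq, SimpleGraph.Walk.cons_isPath_iff,
        SimpleGraph.Walk.length_cons, SimpleGraph.Walk.support_cons, List.tail_cons]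
      exact ⟨⟨⟨hpath, fun h => hsup v h hv⟩, by rw [hlen]⟩, hsup⟩
    · rintro p - ⟨u, p₁⟩ ⟨-, h₁, e₁⟩ ⟨u', p₂⟩ ⟨-, h₂, e₂⟩
      rw [e₁] at e₂
      cases e₂
      rfl

theorem sawCount_le_numSAW {V : Type*} [Fintype V] [DecidableEq V] (G : SimpleGraph V) (l : ℕ)
    {X : Finset V} {v : V} (hv : v ∈ X) : sawCount G l X v ≤ numSAW G v l := by
  classical
  refine (sawCount_le_sum G l hv).trans (Finset.sum_le_sum fun w _ => ?_)
  refine Set.ncard_le_ncard (fun p hp => hp.1) ?_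
  exact (Set.toFinite {p : G.Walk v w | p.length = l}).subset fun p hp => hp.2

/-- The number of nodes of the tree of self-avoiding walks, truncated at depth `r`. -/
noncomputable def nodeCount {V : Type*} [Fintype V] [DecidableEq V] (G : SimpleGraph V)
    (r : ℕ) (X : Finset V) (v : V) : ℕ :=
  ∑ i ∈ range (r + 1), sawCount G i X v

theorem nodeCount_zero {V : Type*} [Fintype V] [DecidableEq V] (G : SimpleGraph V)
    (X : Finset V) (v : V) : nodeCount G 0 X v = 1 := by
  simp [nodeCount, sawCount]

theorem nodeCount_succ {V : Type*} [Fintype V] [DecidableEq V] (G : SimpleGraph V)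
    (r : ℕ) (X : Finset V) (v : V) :
    nodeCount G (r + 1) X v = 1 + ∑ u ∈ succs G X v, nodeCount G r (insert u X) u := by
  rw [nodeCount, Finset.sum_range_succ', add_comm]
  congr 1
  simp only [nodeCount, sawCount]
  rw [Finset.sum_comm]

theorem nodeCount_le {V : Type*} [Fintype V] [DecidableEq V] (G : SimpleGraph V) (l : ℕ)
    {X : Finset V} {v : V} (hv : v ∈ X) :
    nodeCount G l X v ≤ 1 + ∑ i ∈ Icc 1 l, numSAW G v i := by
  have : nodeCount G l X v = 1 + ∑ i ∈ Icc 1 l, sawCount G i X v := by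
    rw [nodeCount, Finset.sum_range_succ', add_comm]
    congr 1
    rw [Finset.range_eq_Ico, Finset.sum_Ico_add' (fun i => sawCount G i X v) 0 l 1]
    rfl
  rw [this]
  gcongr
  exact sawCount_le_numSAW G _ hv

/-! ### The partition function as a telescoping product -/

/-- The vertices of index at least `k`. -/
def upper (n k : ℕ) : Finset (Fin n) := univ.filter fun i => k ≤ (i : ℕ)

theorem mem_upper {n k : ℕ} {i : Fin n} : i ∈ upper n k ↔ k ≤ (i : ℕ) := by simp [upper]

theorem upper_erase {n : ℕ} (k : Fin n) : (upper n k).erase k = upper n (k + 1) := by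
  ext i
  rw [mem_erase, mem_upper, mem_upper, ne_eq, Fin.ext_iff]
  omega

/-- Each factor is a ratio of weights for two consecutive sets `upper n k`, so the product
telescopes from the empty graph, of weight `1`, to all of `G`. -/
theorem prod_uncovered {γ : ℝ} (hγ : 0 ≤ γ) {n : ℕ} (G : SimpleGraph (Fin n)) :
    ∏ k : Fin n, 1 / uncovered γ G (upper n k) k = partitionFunction γ G := by
  have h : ∀ k : Fin n, 1 / uncovered γ G (upper n k) k =
      (fun j : ℕ => avoidingZ γ G (upper n (j + 1)) / avoidingZ γ G (upper n j)) k := fun k => by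
    simp only [uncovered, upper_erase, one_div_div]
  rw [Finset.prod_congr rfl fun k _ => h k,
    Fin.prod_univ_eq_prod_range
      (fun j : ℕ => avoidingZ γ G (upper n (j + 1)) / avoidingZ γ G (upper n j)) n]
  have ht : ∀ j, ∏ i ∈ range j, (avoidingZ γ G (upper n (i + 1)) / avoidingZ γ G (upper n i)) =
      avoidingZ γ G (upper n j) / avoidingZ γ G (upper n 0) := by
    intro j
    induction j with
    | zero => simp [div_self (avoidingZ_pos hγ G _).ne']
    | succ j ih =>
      rw [Finset.prod_range_succ, ih]
      have := (avoidingZ_pos hγ G (upper n j)).ne'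
      field_simp
  rw [ht]
  have h0 : upper n 0 = univ := by ext i; simp [upper]
  have hn : upper n n = ∅ := by
    ext i; simp [upper]
  rw [h0, hn, avoidingZ_univ, avoidingZ_empty, div_one]

/-! ### Effect of rounding the activity and of truncation on the partition function -/

theorem IsMatchingSet.card_le {V : Type*} [Fintype V] {G : SimpleGraph V}
    {M : Finset (Sym2 V)} (hM : IsMatchingSet G M) : M.card ≤ Fintype.card V := by
  -- One endpoint is picked from each edge; disjointness of the edges makes this injective.
  refine Finset.card_le_card_of_injOn (t := univ) (fun e => (Quot.out e).1) (fun _ _ => by simp) ?_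
  intro e he e' he' h
  by_contra hne
  refine hM.2 e he e' he' hne (Quot.out e).1 ⟨Sym2.out_fst_mem e, ?_⟩
  have h' : (Quot.out e).1 = (Quot.out e').1 := h
  rw [h']
  exact Sym2.out_fst_mem e'

theorem partitionFunction_nonneg {V : Type*} [Fintype V] {γ : ℝ} (hγ : 0 ≤ γ)
    (G : SimpleGraph V) : 0 ≤ partitionFunction γ G :=
  Finset.sum_nonneg fun M _ => by positivity

theorem partitionFunction_mono {V : Type*} [Fintype V] {γ γ' : ℝ} (hγ' : 0 ≤ γ') (h : γ' ≤ γ)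
    (G : SimpleGraph V) : partitionFunction γ' G ≤ partitionFunction γ G :=
  Finset.sum_le_sum fun _ _ => pow_le_pow_left₀ hγ' h _

theorem le_partitionFunction {V : Type*} [Fintype V] {γ γ' θ : ℝ} (hγ : 0 ≤ γ) (h0 : 0 ≤ θ)
    (h1 : θ ≤ 1) (h : θ * γ ≤ γ') (G : SimpleGraph V) :
    θ ^ Fintype.card V * partitionFunction γ G ≤ partitionFunction γ' G := by
  rw [partitionFunction, partitionFunction, Finset.mul_sum]
  refine Finset.sum_le_sum fun M hM => ?_
  simp only [mem_filter, mem_univ, true_and] at hM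
  calc θ ^ Fintype.card V * γ ^ M.card ≤ θ ^ M.card * γ ^ M.card := by
        gcongr ?_ * _
        exact pow_le_pow_of_le_one h0 h1 hM.card_le
    _ = (θ * γ) ^ M.card := by rw [mul_pow]
    _ ≤ _ := pow_le_pow_left₀ (by positivity) h _

theorem prod_truncated_bounds {γ δ : ℝ} (hγ : 0 ≤ γ) {n r : ℕ} (G : SimpleGraph (Fin n))
    (h : ∀ k : Fin n, |message (uncovered γ G (upper n k) k) -
      message (truncated γ G r (upper n k) k)| ≤ δ) :
    ∏ k : Fin n, 1 / truncated γ G r (upper n k) k ≤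
        Real.exp (n * δ) * partitionFunction γ G ∧
      partitionFunction γ G ≤
        Real.exp (n * δ) * ∏ k : Fin n, 1 / truncated γ G r (upper n k) k := by
  have hk : ∀ k : Fin n, k ∈ upper n k := fun k => mem_upper.2 le_rfl
  have e : Real.exp (n * δ) = ∏ _k : Fin n, Real.exp δ := by
    rw [Finset.prod_const, card_univ, Fintype.card_fin, ← Real.exp_nat_mul]
  rw [e, ← prod_uncovered hγ G, ← Finset.prod_mul_distrib, ← Finset.prod_mul_distrib]
  constructor
  · refine Finset.prod_le_prod (fun k _ => ?_) fun k _ => ?_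
    · exact one_div_nonneg.2 (truncated_pos hγ G r _ k).le
    · refine le_exp_mul_of_message (truncated_pos hγ G r _ k) (truncated_le_one hγ G r _ k)
        (uncovered_pos hγ G _ k) (uncovered_le_one hγ G (hk k)) ?_
      rw [abs_sub_comm]; exact h k
  · refine Finset.prod_le_prod (fun k _ => ?_) fun k _ => ?_
    · exact one_div_nonneg.2 (uncovered_pos hγ G _ k).le
    · exact le_exp_mul_of_message (uncovered_pos hγ G _ k) (uncovered_le_one hγ G (hk k))
        (truncated_pos hγ G r _ k) (truncated_le_one hγ G r _ k) (h k)

/-- The leaf error `2γn` must shrink to `1 / (4nm)`, a ratio of `8γn²m`, and only the `(q + 1)`-th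
power of the error halves per level; this is the condition `hl`. -/
theorem message_error_le {γ γ' Δ c : ℝ} (hγ' : 0 ≤ γ') (hle : γ' ≤ γ) (hΔ : 1 ≤ Δ)
    {q n m l : ℕ} (hn : 0 < n) (hm : 0 < m) (hc : 0 ≤ c)
    (hq : 8 * γ * Δ ≤ ((q + 1 : ℕ) : ℝ) ^ 2) (G : SimpleGraph (Fin n)) {X : Finset (Fin n)}
    {v : Fin n} (hv : v ∈ X) (hcount : (sawCount G l X v : ℝ) ≤ c * Δ ^ l)
    (hl : c * (8 * γ * (n : ℝ) ^ 2 * m) ^ (q + 1) ≤ 2 ^ l) :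
    |message (uncovered γ' G X v) - message (truncated γ' G l X v)| ≤ 1 / (4 * n * m) := by
  have hn' : (0 : ℝ) < n := by exact_mod_cast hn
  have hm' : (0 : ℝ) < m := by exact_mod_cast hm
  have hγ : 0 ≤ γ := hγ'.trans hle
  refine le_of_pow_le_pow_left₀ (n := q + 1) (by omega) (by positivity) ?_
  refine (truncation_error hγ' G q l hv).trans ?_
  -- The reason for `hq`: the contraction factor times the growth rate of the walks is at most `1 /
  -- 2`.
  have hα : 4 * γ' / ((q + 1 : ℕ) : ℝ) ^ 2 * Δ ≤ 1 / 2 := by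
    rw [div_mul_eq_mul_div, div_le_iff₀ (by positivity)]
    nlinarith
  have hα0 : 0 ≤ 4 * γ' / ((q + 1 : ℕ) : ℝ) ^ 2 := by positivity
  rw [Fintype.card_fin]
  calc (4 * γ' / ((q + 1 : ℕ) : ℝ) ^ 2) ^ l * (sawCount G l X v) * (2 * γ' * n) ^ (q + 1)
      ≤ (4 * γ' / ((q + 1 : ℕ) : ℝ) ^ 2) ^ l * (c * Δ ^ l) * (2 * γ * n) ^ (q + 1) := by
        gcongr
    _ = (4 * γ' / ((q + 1 : ℕ) : ℝ) ^ 2 * Δ) ^ l * (c * (2 * γ * n) ^ (q + 1)) := by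
        rw [mul_pow]; ring
    _ ≤ (1 / 2) ^ l * (c * (2 * γ * n) ^ (q + 1)) := by
        gcongr
    _ ≤ (1 / (4 * n * m)) ^ (q + 1) := by
        rw [div_pow, div_pow, one_pow, one_pow, div_mul_eq_mul_div, one_mul,
          div_le_div_iff₀ (by positivity) (by positivity), one_mul]
        refine le_trans (le_of_eq ?_) hl
        rw [mul_assoc, ← mul_pow]; congr 2; ring

/-- The product of the truncated recurrences approximates the partition function. -/
theorem prod_truncated_approx {γ γ' Δ c ε : ℝ} (hγ' : 0 ≤ γ') (hle : γ' ≤ γ) (hΔ : 1 ≤ Δ)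
    {q n m l : ℕ} (hn : 0 < n) (hm : 0 < m) (hc : 0 ≤ c)
    (hq : 8 * γ * Δ ≤ ((q + 1 : ℕ) : ℝ) ^ 2) (G : SimpleGraph (Fin n))
    (hcount : ∀ (X : Finset (Fin n)) (v : Fin n), v ∈ X → (sawCount G l X v : ℝ) ≤ c * Δ ^ l)
    (hl : c * (8 * γ * (n : ℝ) ^ 2 * m) ^ (q + 1) ≤ 2 ^ l)
    (hε0 : 0 < ε) (hε1 : ε ≤ 1) (hεm : 1 / ε ≤ m)
    (hθ : (1 - 1 / (4 * n * m)) * γ ≤ γ') :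
    (1 - ε) * partitionFunction γ G ≤ ∏ k : Fin n, 1 / truncated γ' G l (upper n k) k ∧
      ∏ k : Fin n, 1 / truncated γ' G l (upper n k) k ≤ (1 + ε) * partitionFunction γ G := by
  have hn' : (0 : ℝ) < n := by exact_mod_cast hn
  have hm' : (0 : ℝ) < m := by exact_mod_cast hm
  have hn1 : (1 : ℝ) ≤ n := by exact_mod_cast hn
  have hm1 : (1 : ℝ) ≤ m := by exact_mod_cast hm
  have hγ : 0 ≤ γ := hγ'.trans hle
  obtain ⟨h1, h2⟩ := prod_truncated_bounds hγ' G (r := l) fun k =>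
    message_error_le hγ' hle hΔ hn hm hc hq G (mem_upper.2 le_rfl : k ∈ upper n k)
      (hcount _ _ (mem_upper.2 le_rfl)) hl
  have h3 := partitionFunction_mono hγ' hle G
  have hθ1 : 1 / (4 * n * m : ℝ) ≤ 1 := by
    rw [div_le_one (by positivity)]; nlinarith
  have h4 := le_partitionFunction hγ (by linarith) (by
    have : 0 < 1 / (4 * n * m : ℝ) := by positivity
    linarith) hθ G
  rw [Fintype.card_fin] at h4
  have hx : (n : ℝ) * (1 / (4 * n * m)) ≤ ε / 4 := by
    rw [div_le_iff₀ hε0] at hεm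
    have : (n : ℝ) * (1 / (4 * n * m)) = 1 / (4 * m) := by field_simp
    rw [this, div_le_div_iff₀ (by positivity) (by norm_num)]
    nlinarith
  have hb := one_add_mul_le_pow (a := -(1 / (4 * n * m : ℝ))) (by linarith) n
  have hb' : 1 - ε / 4 ≤ (1 - 1 / (4 * n * m : ℝ)) ^ n := by
    calc 1 - ε / 4 ≤ 1 + n * -(1 / (4 * n * m : ℝ)) := by linarith
      _ ≤ _ := by rw [sub_eq_add_neg]; exact hb
  have hZ := partitionFunction_nonneg hγ G
  set Z := partitionFunction γ G
  set Z' := partitionFunction γ' G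
  set P := ∏ k : Fin n, 1 / truncated γ' G l (upper n k) k
  -- The `n` factors together lose `exp (1 / (4m))`, at most `exp (ε / 4)`; rounding the activity
  -- loses another `1 - ε / 4`.
  set E := Real.exp (n * (1 / (4 * n * m)))
  have hE0 : 0 < E := Real.exp_pos _
  have hE : E * (1 - ε / 4) ≤ 1 := by
    have h5 : E ≤ Real.exp (ε / 4) := Real.exp_le_exp.2 hx
    have h6 := Real.one_sub_le_exp_neg (ε / 4)
    calc E * (1 - ε / 4) ≤ Real.exp (ε / 4) * Real.exp (-(ε / 4)) :=
          mul_le_mul h5 h6 (by linarith) (Real.exp_pos _).le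
      _ = 1 := by rw [← Real.exp_add]; simp
  have h7 : (1 - ε / 4) * Z ≤ Z' := le_trans (mul_le_mul_of_nonneg_right hb' hZ) h4
  constructor
  · have h8 : (1 - ε / 4) * Z' ≤ P := by
      calc (1 - ε / 4) * Z' ≤ (1 - ε / 4) * (E * P) :=
            mul_le_mul_of_nonneg_left h2 (by linarith)
        _ = (E * (1 - ε / 4)) * P := by ring
        _ ≤ 1 * P := mul_le_mul_of_nonneg_right hE
            (Finset.prod_nonneg fun k _ => one_div_nonneg.2 (truncated_pos hγ' G l _ k).le)
        _ = P := one_mul P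
    have h9 : (1 - ε / 4) * ((1 - ε / 4) * Z) ≤ (1 - ε / 4) * Z' :=
      mul_le_mul_of_nonneg_left h7 (by linarith)
    nlinarith [mul_nonneg hZ (sq_nonneg ε), mul_nonneg hZ hε0.le]
  · have h10 : E ≤ 1 + ε := by
      have : 1 ≤ (1 + ε) * (1 - ε / 4) := by nlinarith
      have h11 : E * (1 - ε / 4) ≤ (1 + ε) * (1 - ε / 4) := hE.trans this
      exact le_of_mul_le_mul_right h11 (by linarith)
    calc P ≤ E * Z' := h1
      _ ≤ (1 + ε) * Z := mul_le_mul h10 h3 (partitionFunction_nonneg hγ' G) (by linarith)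

end MonomerDimer

namespace MonomerDimer

/-! ### Executing programs -/

theorem size_add_le (x y : ℕ) : Nat.size (x + y) ≤ Nat.size x + Nat.size y + 1 := by
  rw [Nat.size_le, pow_succ, pow_add]
  have hx := Nat.lt_size_self x
  have hy := Nat.lt_size_self y
  have h1 : 1 ≤ 2 ^ Nat.size x := Nat.one_le_two_pow
  have h2 : 1 ≤ 2 ^ Nat.size y := Nat.one_le_two_pow
  nlinarith

theorem size_mul_le (x y : ℕ) : Nat.size (x * y) ≤ Nat.size x + Nat.size y := by
  rw [Nat.size_le, pow_add]
  exact Nat.mul_lt_mul'' (Nat.lt_size_self x) (Nat.lt_size_self y)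

theorem size_le_self (x : ℕ) : Nat.size x ≤ x := Nat.size_le.2 Nat.lt_two_pow_self

theorem size_arith_le (op : ArithOp) (x y : ℕ) :
    Nat.size (op.eval x y) ≤ Nat.size x + Nat.size y + 1 := by
  cases op with
  | add => exact size_add_le x y
  | sub => exact (Nat.size_le_size (Nat.sub_le x y)).trans (by omega)
  | mul => exact (size_mul_le x y).trans (by omega)
  | div => exact (Nat.size_le_size (Nat.div_le_self x y)).trans (by omega)

theorem size_floor_mul_le {γ : ℝ} (x : ℕ) :
    Nat.size ⌊γ * (x : ℝ)⌋₊ ≤ Nat.size ⌈γ⌉₊ + Nat.size x := by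
  refine le_trans (Nat.size_le_size ?_) (size_mul_le _ _)
  refine Nat.floor_le_of_le ?_
  push_cast
  exact mul_le_mul_of_nonneg_right (Nat.le_ceil γ) (Nat.cast_nonneg x)

/-- The sequential composition of a list of programs. -/
def Prog.ofList : List Prog → Prog
  | [] => .skip
  | P :: l => .seq P (Prog.ofList l)

/-- The program contains no loop. -/
def Prog.LoopFree : Prog → Prop
  | .seq P Q => P.LoopFree ∧ Q.LoopFree
  | .ite _ P Q => P.LoopFree ∧ Q.LoopFree
  | .loop _ _ => False
  | _ => True

open Classical in
/-- The effect of a program without loops. -/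
noncomputable def Prog.exec (γ : ℝ) : Prog → Store → Store
  | .skip, s => s
  | .const d k, s => s.setReg d k
  | .copy d x, s => s.setReg d (s.reg x)
  | .arith op d x y, s => s.setReg d (op.eval (s.reg x) (s.reg y))
  | .load d k i, s => s.setReg d (s.arr k (s.reg i))
  | .store k i x, s => s.setArr k (s.reg i) (s.reg x)
  | .param d x, s => s.setReg d ⌊γ * (s.reg x : ℝ)⌋₊
  | .seq P Q, s => Q.exec γ (P.exec γ s)
  | .ite x P Q, s => if s.reg x = 0 then Q.exec γ s else P.exec γ s
  | .loop _ _, s => s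

/-- All the numbers in the store have bit length at most `W`. -/
structure Bounded (W : ℕ) (s : Store) : Prop where
  reg : ∀ i, Nat.size (s.reg i) ≤ W
  arr : ∀ k i, Nat.size (s.arr k i) ≤ W

theorem Bounded.mono {W W' : ℕ} {s : Store} (h : Bounded W s) (hW : W ≤ W') : Bounded W' s :=
  ⟨fun i => (h.reg i).trans hW, fun k i => (h.arr k i).trans hW⟩

theorem Bounded.setReg {W : ℕ} {s : Store} (h : Bounded W s) (d : ℕ) {x : ℕ}
    (hx : Nat.size x ≤ W) : Bounded W (s.setReg d x) := by
  refine ⟨fun i => ?_, h.arr⟩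
  simp only [Store.setReg, Function.update_apply]
  split_ifs
  · exact hx
  · exact h.reg i

theorem Bounded.setArr {W : ℕ} {s : Store} (h : Bounded W s) (k i : ℕ) {x : ℕ}
    (hx : Nat.size x ≤ W) : Bounded W (s.setArr k i x) := by
  refine ⟨h.reg, fun k' i' => ?_⟩
  simp only [Store.setArr, Function.update_apply]
  split_ifs with h1
  · rw [Function.update_apply]
    split_ifs
    · exact hx
    · exact h.arr k i'
  · exact h.arr k' i'

/-- One instruction on numbers of `W` bits costs `O(W)` and produces `O(W)` bits, and this survives
a fixed number of compositions. The size bound would grow exponentially under iteration, so loops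
use only the cost bound and control sizes through the meaning of the numbers. -/
theorem exists_exec_bound (γ : ℝ) (P : Prog) (hP : P.LoopFree) :
    ∃ κ : ℕ, 1 ≤ κ ∧ ∀ (s : Store) (W : ℕ), 1 ≤ W → Bounded W s →
      (∃ t ≤ κ * W, Runs γ P s t (P.exec γ s)) ∧ Bounded (κ * W) (P.exec γ s) := by
  induction P with
  | skip =>
    exact ⟨1, le_rfl, fun s W hW h => ⟨⟨1, by omega, .skip s⟩, h.mono (by omega)⟩⟩
  | const d k =>
    refine ⟨1 + Nat.size k, by omega, fun s W hW h => ?_⟩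
    have : 1 + Nat.size k ≤ (1 + Nat.size k) * W := Nat.le_mul_of_pos_right _ hW
    exact ⟨⟨_, this, .const s d k⟩,
      (h.mono (Nat.le_mul_of_pos_left _ (by omega))).setReg _ (by omega)⟩
  | copy d x =>
    refine ⟨2, by omega, fun s W hW h => ?_⟩
    have := h.reg x
    exact ⟨⟨_, by omega, .copy s d x⟩, (h.mono (by omega)).setReg _ (by omega)⟩
  | arith op d x y =>
    refine ⟨3, by omega, fun s W hW h => ?_⟩
    have h1 := h.reg x
    have h2 := h.reg y
    have h3 := size_arith_le op (s.reg x) (s.reg y)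
    exact ⟨⟨_, by omega, .arith s op d x y⟩, (h.mono (by omega)).setReg _ (by omega)⟩
  | load d k i =>
    refine ⟨3, by omega, fun s W hW h => ?_⟩
    have h1 := h.reg i
    have h2 := h.arr k (s.reg i)
    exact ⟨⟨_, by omega, .load s d k i⟩, (h.mono (by omega)).setReg _ (by omega)⟩
  | store k i x =>
    refine ⟨3, by omega, fun s W hW h => ?_⟩
    have h1 := h.reg i
    have h2 := h.reg x
    exact ⟨⟨_, by omega, .store s k i x⟩, (h.mono (by omega)).setArr _ _ (by omega)⟩
  | param d x =>
    refine ⟨3 + Nat.size ⌈γ⌉₊, by omega, fun s W hW h => ?_⟩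
    have h1 := h.reg x
    have h2 := size_floor_mul_le (γ := γ) (s.reg x)
    have h3 : Nat.size ⌈γ⌉₊ ≤ Nat.size ⌈γ⌉₊ * W := Nat.le_mul_of_pos_right _ hW
    rw [add_mul]
    exact ⟨⟨_, by omega, .param s d x⟩, (h.mono (by omega)).setReg _ (by omega)⟩
  | seq P Q ihP ihQ =>
    obtain ⟨κ, h1, h⟩ := ihP hP.1
    obtain ⟨κ', h1', h'⟩ := ihQ hP.2
    refine ⟨κ + κ' * κ, by omega, fun s W hW hs => ?_⟩
    obtain ⟨⟨t, ht, hr⟩, hb⟩ := h s W hW hs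
    obtain ⟨⟨t', ht', hr'⟩, hb'⟩ := h' _ (κ * W) (Nat.mul_pos h1 hW) hb
    rw [← mul_assoc] at ht' hb'
    exact ⟨⟨t + t', by rw [add_mul]; omega, hr.seq hr'⟩,
      hb'.mono (Nat.mul_le_mul_right _ (by omega))⟩
  | ite x P Q ihP ihQ =>
    obtain ⟨κ, h1, h⟩ := ihP hP.1
    obtain ⟨κ', h1', h'⟩ := ihQ hP.2
    refine ⟨2 + κ + κ', by omega, fun s W hW hs => ?_⟩
    have hx := hs.reg x
    rw [Prog.exec]
    split_ifs with h0
    · obtain ⟨⟨t, ht, hr⟩, hb⟩ := h' s W hW hs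
      exact ⟨⟨_, by rw [add_mul, add_mul]; omega, .ite_false h0 hr⟩,
        hb.mono (Nat.mul_le_mul_right _ (by omega))⟩
    · obtain ⟨⟨t, ht, hr⟩, hb⟩ := h s W hW hs
      exact ⟨⟨_, by rw [add_mul, add_mul]; omega, .ite_true h0 hr⟩,
        hb.mono (Nat.mul_le_mul_right _ (by omega))⟩
  | loop x P => exact hP.elim

/-- Some number of complete iterations of `loop x P`. -/
inductive Iter (γ : ℝ) (x : ℕ) (P : Prog) : Store → ℕ → Store → Prop where
  | refl (s : Store) : Iter γ x P s 0 s
  | step {s s' s'' : Store} {t t' : ℕ} : s.reg x ≠ 0 → Runs γ P s t s' →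
      Iter γ x P s' t' s'' → Iter γ x P s (1 + Nat.size (s.reg x) + t + t') s''

theorem Iter.trans {γ : ℝ} {x : ℕ} {P : Prog} {s s' s'' : Store} {t t' : ℕ}
    (h : Iter γ x P s t s') (h' : Iter γ x P s' t' s'') : Iter γ x P s (t + t') s'' := by
  induction h with
  | refl s => rwa [zero_add]
  | step h0 hr _ ih =>
    rw [add_assoc]
    exact .step h0 hr (ih h')

theorem Iter.runs {γ : ℝ} {x : ℕ} {P : Prog} {s s' : Store} {t : ℕ}
    (h : Iter γ x P s t s') (h0 : s'.reg x = 0) : Runs γ (.loop x P) s (t + 1) s' := by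
  induction h with
  | refl s =>
    have := Runs.loop_exit (γ := γ) (P := P) h0
    rw [h0] at this
    simpa using this
  | step h1 hr _ ih =>
    rw [add_assoc]
    exact .loop_step h1 hr (ih h0)

/-- One iteration whose body is free of loops, with its cost bounded. -/
theorem Iter.exec_step {γ : ℝ} {x : ℕ} {P : Prog} {κ W : ℕ} {s : Store}
    (hκ : ∃ t ≤ κ * W, Runs γ P s t (P.exec γ s)) (hW : 1 ≤ W) (hs : Bounded W s)
    (hx : s.reg x ≠ 0) : ∃ t ≤ (κ + 2) * W, Iter γ x P s t (P.exec γ s) := by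
  obtain ⟨t, ht, hr⟩ := hκ
  have := hs.reg x
  refine ⟨_, ?_, .step hx hr (.refl _)⟩
  rw [add_mul]; omega

/-! ### The algorithm -/

/-- One step of the depth-first search of the tree of self-avoiding walks. Registers: `0` the
number of vertices, `2` the depth limit, `3` and `4` the denominator and the numerator of the
activity, `5` the depth, `9` the constant one. Arrays: `0` the adjacency matrix; `1`, `2`, `3`
and `4` the vertex, the next candidate and the value of the frames on the stack, `5` the marks of
the visited vertices. -/
def searchBody : Prog := .ofList [
  .load 10 1 5, .load 11 2 5, .arith .sub 12 0 11, .arith .sub 13 2 5, .arith .mul 12 12 13,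
  .ite 12
    (.ofList [.arith .add 12 11 9, .store 2 5 12, .arith .mul 12 10 0, .arith .add 12 12 11,
      .load 12 0 12, .load 13 5 11, .arith .sub 13 9 13, .arith .mul 12 12 13,
      .ite 12
        (.ofList [.arith .add 5 5 9, .store 1 5 11, .const 12 0, .store 2 5 12, .store 3 5 9,
          .store 4 5 9, .store 5 11 9])
        .skip])
    (.ofList [.const 12 0, .store 5 10 12, .load 10 3 5, .load 11 4 5, .arith .sub 5 5 9,
      .load 12 3 5, .load 13 4 5, .arith .mul 12 12 10, .arith .mul 12 12 3,
      .arith .mul 11 13 11, .arith .mul 11 11 4, .arith .add 12 12 11, .store 3 5 12,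
      .arith .mul 13 13 10, .arith .mul 13 13 3, .store 4 5 13]),
  .const 10 0, .const 11 0, .const 12 0, .const 13 0]

theorem searchBody_loopFree : searchBody.LoopFree := by
  simp [searchBody, Prog.ofList, Prog.LoopFree]

/-- The constant register holds one, and the temporary registers are clear. -/
structure Ready (s : Store) : Prop where
  one : s.reg 9 = 1
  tmp : s.reg 10 = 0 ∧ s.reg 11 = 0 ∧ s.reg 12 = 0 ∧ s.reg 13 = 0

theorem Store.ext' {s s' : Store} (h1 : s.reg = s'.reg) (h2 : s.arr = s'.arr) : s = s' := by
  cases s; cases s'; simp_all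

/-! ### The three possible effects of a search step: skip a candidate, push it, pop the frame -/

theorem exec_searchBody_skip (γ : ℝ) {s : Store} (h : Ready s)
    (h1 : (s.reg 0 - s.arr 2 (s.reg 5)) * (s.reg 2 - s.reg 5) ≠ 0)
    (h2 : s.arr 0 (s.arr 1 (s.reg 5) * s.reg 0 + s.arr 2 (s.reg 5)) *
      (1 - s.arr 5 (s.arr 2 (s.reg 5))) = 0) :
    searchBody.exec γ s = s.setArr 2 (s.reg 5) (s.arr 2 (s.reg 5) + 1) := by
  obtain ⟨h9, h10, h11, h12, h13⟩ := h
  simp [searchBody, Prog.ofList, Prog.exec, Store.setReg, Store.setArr, ArithOp.eval, h1, h2, h9]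
  funext i
  simp only [Function.update_apply]
  split_ifs <;> simp_all

theorem exec_searchBody_push (γ : ℝ) {s : Store} (h : Ready s)
    (h1 : (s.reg 0 - s.arr 2 (s.reg 5)) * (s.reg 2 - s.reg 5) ≠ 0)
    (h2 : s.arr 0 (s.arr 1 (s.reg 5) * s.reg 0 + s.arr 2 (s.reg 5)) *
      (1 - s.arr 5 (s.arr 2 (s.reg 5))) ≠ 0) :
    searchBody.exec γ s =
      ((((((s.setArr 2 (s.reg 5) (s.arr 2 (s.reg 5) + 1)).setReg 5 (s.reg 5 + 1)).setArr 1
        (s.reg 5 + 1) (s.arr 2 (s.reg 5))).setArr 2 (s.reg 5 + 1) 0).setArr 3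
        (s.reg 5 + 1) 1).setArr 4 (s.reg 5 + 1) 1).setArr 5 (s.arr 2 (s.reg 5)) 1 := by
  obtain ⟨h9, h10, h11, h12, h13⟩ := h
  simp [searchBody, Prog.ofList, Prog.exec, Store.setReg, Store.setArr, ArithOp.eval, h1, h2, h9]
  funext i
  simp only [Function.update_apply]
  split_ifs <;> simp_all

theorem exec_searchBody_pop (γ : ℝ) {s : Store} (h : Ready s)
    (h1 : (s.reg 0 - s.arr 2 (s.reg 5)) * (s.reg 2 - s.reg 5) = 0) :
    searchBody.exec γ s =
      (((s.setArr 5 (s.arr 1 (s.reg 5)) 0).setReg 5 (s.reg 5 - 1)).setArr 3 (s.reg 5 - 1)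
        (s.arr 3 (s.reg 5 - 1) * s.arr 3 (s.reg 5) * s.reg 3 +
          s.arr 4 (s.reg 5 - 1) * s.arr 4 (s.reg 5) * s.reg 4)).setArr 4 (s.reg 5 - 1)
        (s.arr 4 (s.reg 5 - 1) * s.arr 3 (s.reg 5) * s.reg 3) := by
  obtain ⟨h9, h10, h11, h12, h13⟩ := h
  simp [searchBody, Prog.ofList, Prog.exec, Store.setReg, Store.setArr, ArithOp.eval, h1, h9]
  funext i
  simp only [Function.update_apply]
  split_ifs <;> simp_all

theorem Store.setArr_arr_of_ne (s : Store) {k i k' i' : ℕ} (x : ℕ) (h : k' ≠ k ∨ i' ≠ i) :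
    (s.setArr k i x).arr k' i' = s.arr k' i' := by
  rw [Store.setArr]
  dsimp only
  rw [Function.update_apply]
  split_ifs with hk
  · subst hk
    rw [Function.update_of_ne (by simpa using h)]
  · rfl

theorem Store.setReg_arr (s : Store) (d x : ℕ) : (s.setReg d x).arr = s.arr := rfl

/-! ### Mathematical model of the search -/

/-- The value of a frame after its child with value `c` has been processed. -/
def comb (N g : ℕ) (a c : ℕ × ℕ) : ℕ × ℕ :=
  (a.1 * c.1 * N + a.2 * c.2 * g, a.2 * c.1 * N)

/-- The fraction that the search computes below the vertex `v`, up to depth `r`. -/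
def treeValue (n N g : ℕ) (E : ℕ → ℕ) : ℕ → (ℕ → ℕ) → ℕ → ℕ × ℕ
  | 0, _, _ => (1, 1)
  | r + 1, vis, v => (List.range n).foldl (fun a u => if E (v * n + u) * (1 - vis u) = 0 then a
      else comb N g a (treeValue n N g E r (Function.update vis u 1) u)) (1, 1)

/-- The number of nodes that the search visits below the vertex `v`, up to depth `r`. -/
def treeSize (n : ℕ) (E : ℕ → ℕ) : ℕ → (ℕ → ℕ) → ℕ → ℕ
  | 0, _, _ => 1
  | r + 1, vis, v => 1 + ((List.range n).map fun u => if E (v * n + u) * (1 - vis u) = 0 then 0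
      else treeSize n E r (Function.update vis u 1) u).sum

/-- The invariant of the values of frames. -/
def Good (a : ℕ × ℕ) : Prop := 1 ≤ a.2 ∧ a.2 ≤ a.1

/-- Numerators only grow and dominate denominators. Hence a bit bound for the final numerator bounds
all the fractions met on the way. -/
theorem Good.comb {N g : ℕ} (hN : 1 ≤ N) {a c : ℕ × ℕ} (ha : Good a) (hc : Good c) :
    Good (comb N g a c) ∧ a.1 ≤ (comb N g a c).1 ∧ c.1 ≤ (comb N g a c).1 := by
  obtain ⟨ha1, ha2⟩ := ha
  obtain ⟨hc1, hc2⟩ := hc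
  have h1 : 1 ≤ a.1 := ha1.trans ha2
  have h2 : 1 ≤ c.1 := hc1.trans hc2
  simp only [MonomerDimer.comb, Good]
  refine ⟨⟨Nat.mul_pos (Nat.mul_pos ha1 h2) hN, le_trans ?_ (Nat.le_add_right _ _)⟩,
    le_trans ?_ (Nat.le_add_right _ _), le_trans ?_ (Nat.le_add_right _ _)⟩
  · gcongr
  · rw [mul_assoc]; exact Nat.le_mul_of_pos_right _ (Nat.mul_pos h2 hN)
  · rw [mul_comm a.1, mul_assoc]; exact Nat.le_mul_of_pos_right _ (Nat.mul_pos h1 hN)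

theorem Good.foldl {N g : ℕ} (hN : 1 ≤ N) (p : ℕ → Prop) [DecidablePred p] (f : ℕ → ℕ × ℕ)
    (hf : ∀ u, Good (f u)) (l : List ℕ) {a : ℕ × ℕ} (ha : Good a) :
    Good (l.foldl (fun a u => if p u then a else MonomerDimer.comb N g a (f u)) a) ∧
      a.1 ≤ (l.foldl (fun a u => if p u then a else MonomerDimer.comb N g a (f u)) a).1 := by
  induction l generalizing a with
  | nil => exact ⟨ha, le_rfl⟩
  | cons u l ih =>
    rw [List.foldl_cons]
    split_ifs with h
    · exact ih ha
    · obtain ⟨h1, h2, -⟩ := ha.comb (g := g) hN (hf u)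
      exact ⟨(ih h1).1, h2.trans (ih h1).2⟩

theorem treeValue_good {n N g : ℕ} (hN : 1 ≤ N) (E : ℕ → ℕ) (r : ℕ) (vis : ℕ → ℕ) (v : ℕ) :
    Good (treeValue n N g E r vis v) := by
  induction r generalizing vis v with
  | zero => simp [treeValue, Good]
  | succ r ih =>
    rw [treeValue]
    exact (Good.foldl hN _ _ (fun u => ih _ u) _ (by simp [Good])).1

/-! ### Correctness and cost of the search -/

/-- The stores agree except for the contents of the stack above depth `d`. -/
structure SameBelow (d : ℕ) (s s' : Store) : Prop where
  reg : s'.reg = s.reg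
  adj : s'.arr 0 = s.arr 0
  vis : s'.arr 5 = s.arr 5
  below : ∀ k, ∀ j < d, s'.arr k j = s.arr k j
  vertex : s'.arr 1 d = s.arr 1 d

theorem SameBelow.trans {d : ℕ} {s s' s'' : Store} (h : SameBelow d s s')
    (h' : SameBelow d s' s'') : SameBelow d s s'' :=
  ⟨h'.reg.trans h.reg, h'.adj.trans h.adj, h'.vis.trans h.vis,
    fun k j hj => (h'.below k j hj).trans (h.below k j hj), h'.vertex.trans h.vertex⟩

theorem SameBelow.refl (d : ℕ) (s : Store) : SameBelow d s s :=
  ⟨rfl, rfl, rfl, fun _ _ _ => rfl, rfl⟩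

/-- The parameters of the search are in their registers, and the search is at depth `d`. -/
structure Searching (n L N g : ℕ) (E : ℕ → ℕ) (d : ℕ) (s : Store) : Prop where
  ready : Ready s
  r0 : s.reg 0 = n
  r2 : s.reg 2 = L
  r3 : s.reg 3 = N
  r4 : s.reg 4 = g
  r5 : s.reg 5 = d
  adj : s.arr 0 = E

theorem Searching.congr {n L N g d : ℕ} {E : ℕ → ℕ} {s s' : Store}
    (h : Searching n L N g E d s) (hr : s'.reg = s.reg) (ha : s'.arr 0 = s.arr 0) :
    Searching n L N g E d s' := by
  obtain ⟨⟨h1, h2⟩, h3, h4, h5, h6, h7, h8⟩ := h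
  exact ⟨⟨by rw [hr, h1], by rw [hr]; exact h2⟩, by rw [hr, h3], by rw [hr, h4], by rw [hr, h5],
    by rw [hr, h6], by rw [hr, h7], by rw [ha, h8]⟩

theorem Searching.update {n L N g d : ℕ} {E : ℕ → ℕ} {s s' : Store} {d' : ℕ}
    (h : Searching n L N g E d s) (hr : s'.reg = Function.update s.reg 5 d')
    (ha : s'.arr 0 = s.arr 0) : Searching n L N g E d' s' := by
  obtain ⟨⟨h1, h2⟩, h3, h4, h5, h6, h7, h8⟩ := h
  refine ⟨⟨?_, ?_⟩, ?_, ?_, ?_, ?_, ?_, by rw [ha, h8]⟩ <;> rw [hr] <;> simp [*]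

/-- A bound for the cost of a program without loops. -/
def CostBound (γ : ℝ) (P : Prog) (κ : ℕ) : Prop :=
  ∀ (s : Store) (W : ℕ), 1 ≤ W → Bounded W s → ∃ t ≤ κ * W, Runs γ P s t (P.exec γ s)

/-- Started on a fresh frame with remaining depth `r`, the search exhausts the frame and computes
its value. -/
def FrameSpec (γ : ℝ) (κ W n L N g : ℕ) (E : ℕ → ℕ) (r : ℕ) : Prop :=
  ∀ (s : Store) (d v : ℕ) (vis : ℕ → ℕ), Searching n L N g E d s → d + r = L → 1 ≤ d →
    s.arr 1 d = v → s.arr 2 d = 0 → s.arr 3 d = 1 → s.arr 4 d = 1 → s.arr 5 = vis →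
    Bounded W s → Nat.size (treeValue n N g E r vis v).1 ≤ W →
    ∃ t s', Iter γ 5 searchBody s t s' ∧
      t + (κ + 2) * W ≤ (κ + 2) * W * (n + 1) * treeSize n E r vis v ∧
      SameBelow d s s' ∧ (n - s'.arr 2 d) * (L - d) = 0 ∧
      s'.arr 3 d = (treeValue n N g E r vis v).1 ∧ s'.arr 4 d = (treeValue n N g E r vis v).2 ∧
      Bounded W s'

-- Induction on the number `j` of candidates left in the frame, given `FrameSpec` for the children.
-- Each candidate costs one iteration, plus the search of its subtree if it is pushed. The summand
-- `(κ + 2) * W` on the left of the cost bound in `FrameSpec` is a credit for one further iteration: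
-- it pays for popping the child.
set_option maxHeartbeats 800000 in
theorem search_candidates {γ : ℝ} {κ W n L N g : ℕ} {E : ℕ → ℕ} (hκ : CostBound γ searchBody κ) (hW : 1 ≤ W)
    (hN : 1 ≤ N) {r : ℕ} (ih : FrameSpec γ κ W n L N g E r) (j : ℕ) :
    ∀ (u : ℕ) (s : Store) (a : ℕ × ℕ) (d v : ℕ) (vis : ℕ → ℕ), u + j = n →
    Searching n L N g E d s → d + (r + 1) = L → 1 ≤ d →
    s.arr 1 d = v → s.arr 2 d = u → s.arr 3 d = a.1 → s.arr 4 d = a.2 → s.arr 5 = vis →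
    Good a → Bounded W s →
    ∀ res, res = (List.range' u j).foldl (fun a u => if E (v * n + u) * (1 - vis u) = 0 then a
      else comb N g a (treeValue n N g E r (Function.update vis u 1) u)) a →
    Nat.size res.1 ≤ W →
    ∃ t s', Iter γ 5 searchBody s t s' ∧
      t ≤ (κ + 2) * W * j + (κ + 2) * W * (n + 1) * ((List.range' u j).map fun u =>
        if E (v * n + u) * (1 - vis u) = 0 then 0
        else treeSize n E r (Function.update vis u 1) u).sum ∧
      SameBelow d s s' ∧ s'.arr 2 d = n ∧ s'.arr 3 d = res.1 ∧ s'.arr 4 d = res.2 ∧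
      Bounded W s' := by
  induction j with
  | zero =>
    rintro u s a d v vis hu hs hd hd1 h1 h2 h3 h4 h5 ha hb res rfl hres
    exact ⟨0, s, .refl s, by simp, .refl d s, by omega, h3, h4, hb⟩
  | succ j ihj =>
    intro u s a d v vis hu hs hd hd1 h1 h2 h3 h4 h5 ha hb res hr hres
    have hgood : ∀ u, Good (treeValue n N g E r (Function.update vis u 1) u) :=
      fun u => treeValue_good hN E r _ u
    rw [List.range'_succ, List.foldl_cons] at hr
    rw [List.range'_succ, List.map_cons, List.sum_cons]
    have hne : s.reg 5 ≠ 0 := by rw [hs.r5]; omega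
    obtain ⟨t₁, ht₁, hi₁⟩ := Iter.exec_step (hκ s W hW hb) hW hb hne
    have hsn : Nat.size n ≤ W := hs.r0 ▸ hb.reg 0
    have hsL : Nat.size L ≤ W := hs.r2 ▸ hb.reg 2
    have hscan : (s.reg 0 - s.arr 2 (s.reg 5)) * (s.reg 2 - s.reg 5) ≠ 0 := by
      rw [hs.r0, hs.r2, hs.r5, h2]
      exact Nat.mul_ne_zero (by omega) (by omega)
    by_cases hc : E (v * n + u) * (1 - vis u) = 0
    · rw [if_pos hc] at hr ⊢
      have he := exec_searchBody_skip γ hs.ready hscan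
        (by rw [hs.r0, hs.r5, hs.adj, h1, h2, h5]; exact hc)
      rw [hs.r5, h2] at he
      rw [he] at hi₁
      set s₁ := s.setArr 2 d (u + 1) with hs₁
      have hsb : SameBelow d s s₁ :=
        ⟨rfl, by simp [hs₁, Store.setArr], by simp [hs₁, Store.setArr], fun k i hi =>
          s.setArr_arr_of_ne _ (by omega), by simp [hs₁, Store.setArr]⟩
      obtain ⟨t, s', hi, ht, hsb', h2', h3', h4', hb'⟩ := ihj (u + 1) s₁ a d v vis (by omega)
        (hs.congr hsb.reg hsb.adj) hd hd1 (hsb.vertex.trans h1) (by simp [hs₁, Store.setArr])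
        (by simp [hs₁, Store.setArr, h3]) (by simp [hs₁, Store.setArr, h4])
        (hsb.vis.trans h5) ha
        (hb.setArr _ _ ((Nat.size_le_size (by omega)).trans hsn)) res hr hres
      refine ⟨_, s', hi₁.trans hi, ?_, hsb.trans hsb', h2', h3', h4', hb'⟩
      rw [zero_add, mul_add, mul_one]
      omega
    · rw [if_neg hc] at hr ⊢
      have hvu : vis u = 0 := by
        by_contra h
        exact hc (by rw [show 1 - vis u = 0 by omega, mul_zero])
      set c := treeValue n N g E r (Function.update vis u 1) u with hcdef
      obtain ⟨hg, hac, hcc⟩ := ha.comb (g := g) hN (hgood u)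
      -- The child's numerator is dominated by the final one, so it too has at most `W` bits.
      have hfold := (Good.foldl (g := g) hN (fun u => E (v * n + u) * (1 - vis u) = 0) _ hgood
        (List.range' (u + 1) j) hg).2
      rw [← hr] at hfold
      have he := exec_searchBody_push γ hs.ready hscan
        (by rw [hs.r0, hs.r5, hs.adj, h1, h2, h5]; exact hc)
      rw [hs.r5, h2] at he
      rw [he] at hi₁
      set s₁ := ((((((s.setArr 2 d (u + 1)).setReg 5 (d + 1)).setArr 1 (d + 1) u).setArr 2
        (d + 1) 0).setArr 3 (d + 1) 1).setArr 4 (d + 1) 1).setArr 5 u 1 with hs₁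
      have hone : Nat.size 1 ≤ W := hs.ready.one ▸ hb.reg 9
      have hb₁ : Bounded W s₁ :=
        ((((((hb.setArr _ _ ((Nat.size_le_size (by omega)).trans hsn)).setReg _
          ((Nat.size_le_size (by omega)).trans hsL)).setArr _ _
          ((Nat.size_le_size (by omega)).trans hsn)).setArr _ _ (by simp)).setArr _ _
          hone).setArr _ _ hone).setArr _ _ hone
      have hS₁ : Searching n L N g E (d + 1) s₁ :=
        hs.update rfl (by simp [hs₁, Store.setArr, Store.setReg])
      obtain ⟨t₂, s₂, hi₂, ht₂, hsb₂, hex₂, h3₂, h4₂, hb₂⟩ := ih s₁ (d + 1) u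
        (Function.update vis u 1) hS₁ (by omega) (by omega)
        (by simp [hs₁, Store.setArr, Store.setReg]) (by simp [hs₁, Store.setArr, Store.setReg])
        (by simp [hs₁, Store.setArr, Store.setReg]) (by simp [hs₁, Store.setArr, Store.setReg])
        (by simp [hs₁, Store.setArr, Store.setReg, h5]) hb₁
        ((Nat.size_le_size (hcc.trans hfold)).trans hres)
      have hS₂ := hS₁.congr hsb₂.reg hsb₂.adj
      obtain ⟨t₃, ht₃, hi₃⟩ := Iter.exec_step (hκ s₂ W hW hb₂) hW hb₂
        (by rw [hS₂.r5]; omega)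
      have he₃ := exec_searchBody_pop γ hS₂.ready (by rw [hS₂.r0, hS₂.r2, hS₂.r5]; exact hex₂)
      have hbel : ∀ k, k ≠ 5 → s₂.arr k d = s₁.arr k d := fun k _ => hsb₂.below k d (by omega)
      rw [hS₂.r5, hS₂.r3, hS₂.r4, Nat.add_sub_cancel, hsb₂.vertex, h3₂, h4₂,
        hbel 3 (by omega), hbel 4 (by omega)] at he₃
      have hA : s₁.arr 3 d = a.1 := by simp [hs₁, Store.setArr, Store.setReg, h3]
      have hB : s₁.arr 4 d = a.2 := by simp [hs₁, Store.setArr, Store.setReg, h4]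
      have hv : s₁.arr 1 (d + 1) = u := by simp [hs₁, Store.setArr, Store.setReg]
      rw [hA, hB, hv] at he₃
      rw [he₃] at hi₃
      set s₃ := (((s₂.setArr 5 u 0).setReg 5 d).setArr 3 d
        (a.1 * c.1 * N + a.2 * c.2 * g)).setArr 4 d (a.2 * c.1 * N) with hs₃
      have hres1 : Nat.size (comb N g a c).1 ≤ W := (Nat.size_le_size hfold).trans hres
      have hres2 : Nat.size (comb N g a c).2 ≤ W := (Nat.size_le_size hg.2).trans hres1
      have hb₃ : Bounded W s₃ :=
        (((hb₂.setArr _ _ (by simp)).setReg _ ((Nat.size_le_size (by omega)).trans hsL)).setArr _ _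
          hres1).setArr _ _ hres2
      -- Popping unmarks `u`, which was unmarked before the push, so the marks are restored.
      have hvis₃ : s₃.arr 5 = vis := by
        have : s₃.arr 5 = Function.update (s₂.arr 5) u 0 := by
          simp [hs₃, Store.setArr, Store.setReg]
        rw [this, hsb₂.vis]
        simp [hs₁, Store.setArr, Store.setReg, h5, ← hvu]
      have hreg₃ : s₃.reg = s.reg := by
        have : s₃.reg = Function.update s₂.reg 5 d := rfl
        rw [this, hsb₂.reg]
        simp [hs₁, Store.setArr, Store.setReg, ← hs.r5]
      have hsb₃ : SameBelow d s s₃ := by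
        refine ⟨hreg₃, ?_, hvis₃.trans h5.symm, fun k i hi => ?_, ?_⟩
        · have : s₃.arr 0 = s₂.arr 0 := by simp [hs₃, Store.setArr, Store.setReg]
          rw [this, hS₂.adj, hs.adj]
        · by_cases hk : k = 5
          · rw [hk, hvis₃, h5]
          · have e1 : s₃.arr k i = s₂.arr k i := by
              rw [hs₃, Store.setArr_arr_of_ne _ _ (by omega), Store.setArr_arr_of_ne _ _ (by omega),
                Store.setReg_arr, Store.setArr_arr_of_ne _ _ (by omega)]
            rw [e1, hsb₂.below k i (by omega), hs₁, Store.setArr_arr_of_ne _ _ (by omega),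
              Store.setArr_arr_of_ne _ _ (by omega), Store.setArr_arr_of_ne _ _ (by omega),
              Store.setArr_arr_of_ne _ _ (by omega), Store.setArr_arr_of_ne _ _ (by omega),
              Store.setReg_arr, Store.setArr_arr_of_ne _ _ (by omega)]
        · have : s₃.arr 1 d = s₂.arr 1 d := by simp [hs₃, Store.setArr, Store.setReg]
          rw [this, hbel 1 (by omega)]
          simp [hs₁, Store.setArr, Store.setReg]
      obtain ⟨t, s', hi, ht, hsb', h2', h3', h4', hb'⟩ := ihj (u + 1) s₃ (comb N g a c) d v vis
        (by omega) (hs.congr hsb₃.reg hsb₃.adj) hd hd1 (hsb₃.vertex.trans h1)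
        (by
          have : s₃.arr 2 d = s₂.arr 2 d := by simp [hs₃, Store.setArr, Store.setReg]
          rw [this, hbel 2 (by omega)]
          simp [hs₁, Store.setArr, Store.setReg])
        (by simp [hs₃, Store.setArr, Store.setReg, comb])
        (by simp [hs₃, Store.setArr, Store.setReg, comb])
        hvis₃ hg hb₃ res hr hres
      refine ⟨_, s', ((hi₁.trans hi₂).trans hi₃).trans hi, ?_, hsb₃.trans hsb', h2', h3', h4', hb'⟩
      rw [mul_add _ j 1, mul_one, mul_add ((κ + 2) * W * (n + 1))]
      omega

theorem search_frame {γ : ℝ} {κ W n L N g : ℕ} {E : ℕ → ℕ} (hκ : CostBound γ searchBody κ) (hW : 1 ≤ W)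
    (hN : 1 ≤ N) (r : ℕ) : FrameSpec γ κ W n L N g E r := by
  induction r with
  | zero =>
    intro s d v vis hs hd hd1 h1 h2 h3 h4 h5 hb hres
    refine ⟨0, s, .refl s, ?_, .refl d s, by rw [show L - d = 0 by omega, mul_zero], h3, h4, hb⟩
    rw [treeSize, mul_one, zero_add]
    exact Nat.le_mul_of_pos_right _ (by omega)
  | succ r ih =>
    intro s d v vis hs hd hd1 h1 h2 h3 h4 h5 hb hres
    obtain ⟨t, s', hi, ht, hsb, h2', h3', h4', hb'⟩ := search_candidates hκ hW hN ih n 0 s (1, 1)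
      d v vis (by omega) hs hd hd1 h1 h2 h3 h4 h5 (by simp [Good]) hb
      (treeValue n N g E (r + 1) vis v) (by rw [treeValue, List.range_eq_range']) hres
    refine ⟨t, s', hi, ?_, hsb, by rw [h2', Nat.sub_self, zero_mul], h3', h4', hb'⟩
    rw [treeSize, mul_add, mul_one, List.range_eq_range', mul_add _ n 1, mul_one]
    rw [mul_add _ n 1, mul_one] at ht
    omega

/-! ### The loop over the roots -/

/-- Push the frame of the next root, the vertex before the one in register `6`. -/
def rootInit : Prog := .ofList [.arith .sub 6 6 9, .store 1 9 6, .const 10 0, .store 2 9 10,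
  .store 3 9 9, .store 4 9 9, .store 5 6 9, .copy 5 9]

/-- Multiply the value of the root into the registers `7` and `8`, and remove the root. -/
def rootDone : Prog := .ofList [.load 10 3 9, .arith .mul 7 7 10, .load 10 4 9,
  .arith .mul 8 8 10, .store 5 6 9, .const 10 0]

/-- The treatment of one root. -/
def rootBody : Prog := .seq rootInit (.seq (.loop 5 searchBody) rootDone)

theorem rootInit_loopFree : rootInit.LoopFree := by
  simp [rootInit, Prog.ofList, Prog.LoopFree]

theorem rootDone_loopFree : rootDone.LoopFree := by
  simp [rootDone, Prog.ofList, Prog.LoopFree]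

theorem exec_rootInit (γ : ℝ) {s : Store} (h : Ready s) :
    rootInit.exec γ s = (((((((s.setReg 6 (s.reg 6 - 1)).setArr 1 1 (s.reg 6 - 1)).setArr
      2 1 0).setArr 3 1 1).setArr 4 1 1).setArr 5 (s.reg 6 - 1) 1).setReg 5 1) := by
  obtain ⟨h9, h10, h11, h12, h13⟩ := h
  simp [rootInit, Prog.ofList, Prog.exec, Store.setReg, Store.setArr, ArithOp.eval, h9]
  funext i
  simp only [Function.update_apply]
  split_ifs <;> simp_all

theorem exec_rootDone (γ : ℝ) {s : Store} (h : Ready s) :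
    rootDone.exec γ s = ((s.setReg 7 (s.reg 7 * s.arr 3 1)).setReg 8
      (s.reg 8 * s.arr 4 1)).setArr 5 (s.reg 6) 1 := by
  obtain ⟨h9, h10, h11, h12, h13⟩ := h
  simp [rootDone, Prog.ofList, Prog.exec, Store.setReg, Store.setArr, ArithOp.eval, h9]
  funext i
  simp only [Function.update_apply]
  split_ifs <;> simp_all

/-- The marks of the vertices of index at least `j`. -/
def marks (n j i : ℕ) : ℕ := if j ≤ i ∧ i < n then 1 else 0

theorem update_marks {n j : ℕ} (hj : j < n) : Function.update (marks n (j + 1)) j 1 = marks n j := by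
  funext i
  simp only [Function.update_apply, marks]
  split_ifs <;> omega

theorem update_marks_self {n j : ℕ} (hj : j < n) :
    Function.update (Function.update (marks n j) j 0) j 1 = marks n j := by
  funext i
  simp only [Function.update_apply, marks]
  split_ifs <;> omega

theorem Searching.of_reg {n L N g d d' : ℕ} {E : ℕ → ℕ} {s s' : Store}
    (h : Searching n L N g E d s) (hr : ∀ i, i < 5 ∨ 8 < i → s'.reg i = s.reg i)
    (h5' : s'.reg 5 = d') (ha : s'.arr 0 = s.arr 0) : Searching n L N g E d' s' := by
  obtain ⟨⟨h1, h2⟩, h3, h4, h5, h6, h7, h8⟩ := h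
  refine ⟨⟨?_, ?_⟩, ?_, ?_, ?_, ?_, h5', by rw [ha, h8]⟩
  · rw [hr _ (by omega), h1]
  · rw [hr _ (by omega), hr _ (by omega), hr _ (by omega), hr _ (by omega)]; exact h2
  · rw [hr _ (by omega), h3]
  · rw [hr _ (by omega), h4]
  · rw [hr _ (by omega), h5]
  · rw [hr _ (by omega), h6]

/-- The state between two roots, when the vertices below `k` remain to be processed. -/
structure Between (W n L N g : ℕ) (E : ℕ → ℕ) (k : ℕ) (s : Store) : Prop where
  searching : Searching n L N g E 0 s
  r6 : s.reg 6 = k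
  vis : s.arr 5 = marks n k
  a3 : s.arr 3 0 = 0
  a4 : s.arr 4 0 = 0
  bounded : Bounded W s

-- The root sits in frame `1`, so `L - 1` levels remain below it. The last pop brings the depth to
-- `0`, which ends the search loop; the value of the popped frame stays readable in the arrays. That
-- pop also unmarks the root, and `rootDone` marks it again to remove it for the later roots.
set_option maxHeartbeats 800000 in
theorem run_root {γ : ℝ} {κ W n L N g : ℕ} {E : ℕ → ℕ} (hκ : CostBound γ searchBody κ)
    (hκ₁ : CostBound γ rootInit κ) (hκ₂ : CostBound γ rootDone κ) (hW : 1 ≤ W)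
    (hN : 1 ≤ N) (hL : 1 ≤ L) {j B : ℕ} (hj : j < n)
    (hB : treeSize n E (L - 1) (marks n j) j ≤ B) (hB1 : 1 ≤ B) {s : Store}
    (hs : Between W n L N g E (j + 1) s) {c : ℕ × ℕ}
    (hc : c = treeValue n N g E (L - 1) (marks n j) j) (h7 : 1 ≤ s.reg 7)
    (hs7 : Nat.size (s.reg 7 * c.1) ≤ W) (hs8 : Nat.size (s.reg 8 * c.2) ≤ W) :
    ∃ t s', Iter γ 6 rootBody s t s' ∧ t ≤ 3 * ((κ + 2) * W * (n + 1) * B) ∧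
      Between W n L N g E j s' ∧ s'.reg 7 = s.reg 7 * c.1 ∧ s'.reg 8 = s.reg 8 * c.2 := by
  obtain ⟨hS, h6, hvis, ha3, ha4, hb⟩ := hs
  have hone : Nat.size 1 ≤ W := hS.ready.one ▸ hb.reg 9
  have hsn : Nat.size n ≤ W := hS.r0 ▸ hb.reg 0
  have hsj : Nat.size j ≤ W := (Nat.size_le_size hj.le).trans hsn
  have hsc : Nat.size c.1 ≤ W :=
    (Nat.size_le_size (Nat.le_mul_of_pos_left _ h7)).trans hs7
  obtain ⟨t₁, ht₁, hr₁⟩ := hκ₁ s W hW hb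
  rw [exec_rootInit γ hS.ready, h6, Nat.add_sub_cancel] at hr₁
  set s₁ := (((((((s.setReg 6 j).setArr 1 1 j).setArr 2 1 0).setArr 3 1 1).setArr 4 1 1).setArr
    5 j 1).setReg 5 1) with hs₁
  have hb₁ : Bounded W s₁ :=
    ((((((hb.setReg _ hsj).setArr _ _ hsj).setArr _ _ (by simp)).setArr _ _ hone).setArr
      _ _ hone).setArr _ _ hone).setReg _ hone
  have hS₁ : Searching n L N g E 1 s₁ := by
    refine hS.of_reg (fun i hi => ?_) (by simp [hs₁, Store.setReg])
      (by simp [hs₁, Store.setReg, Store.setArr])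
    simp only [hs₁, Store.setReg, Store.setArr]
    rw [Function.update_of_ne (by omega), Function.update_of_ne (by omega)]
  have hv₁ : s₁.arr 1 1 = j := by simp [hs₁, Store.setReg, Store.setArr]
  have hvis₁ : s₁.arr 5 = marks n j := by
    rw [← update_marks hj, ← hvis]
    simp [hs₁, Store.setReg, Store.setArr]
  have ha3₁ : s₁.arr 3 0 = 0 := by simp [hs₁, Store.setReg, Store.setArr, ha3]
  have ha4₁ : s₁.arr 4 0 = 0 := by simp [hs₁, Store.setReg, Store.setArr, ha4]
  have h6₁ : s₁.reg 6 = j := by simp [hs₁, Store.setReg, Store.setArr]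
  have h7₁ : s₁.reg 7 = s.reg 7 := by simp [hs₁, Store.setReg, Store.setArr]
  have h8₁ : s₁.reg 8 = s.reg 8 := by simp [hs₁, Store.setReg, Store.setArr]
  obtain ⟨t₂, s₂, hi₂, ht₂, hsb₂, hex₂, h3₂, h4₂, hb₂⟩ :=
    search_frame (γ := γ) (L := L) (g := g) hκ hW hN (L - 1) s₁ 1 j (marks n j) hS₁ (by omega)
      le_rfl hv₁ (by simp [hs₁, Store.setReg, Store.setArr])
      (by simp [hs₁, Store.setReg, Store.setArr]) (by simp [hs₁, Store.setReg, Store.setArr])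
      hvis₁ hb₁ (hc ▸ hsc)
  rw [← hc] at h3₂ h4₂
  have hS₂ := hS₁.congr hsb₂.reg hsb₂.adj
  obtain ⟨t₃, ht₃, hi₃⟩ := Iter.exec_step (hκ s₂ W hW hb₂) hW hb₂ (by rw [hS₂.r5]; omega)
  have he₃ := exec_searchBody_pop γ hS₂.ready (by rw [hS₂.r0, hS₂.r2, hS₂.r5]; exact hex₂)
  -- The last pop combines the root into the dummy frame `0`, whose entries are `0` and remain so.
  rw [hS₂.r5, Nat.sub_self, hsb₂.vertex, hv₁, hsb₂.below 3 0 (by omega),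
    hsb₂.below 4 0 (by omega), ha3₁, ha4₁] at he₃
  simp only [zero_mul, add_zero] at he₃
  rw [he₃] at hi₃
  set s₃ := (((s₂.setArr 5 j 0).setReg 5 0).setArr 3 0 0).setArr 4 0 0 with hs₃
  have hb₃ : Bounded W s₃ := (((hb₂.setArr _ _ (by simp)).setReg _ (by simp)).setArr _ _
    (by simp)).setArr _ _ (by simp)
  have hreg₃ : s₃.reg = Function.update s₁.reg 5 0 := by
    rw [← hsb₂.reg]; rfl
  have hS₃ : Searching n L N g E 0 s₃ :=
    hS₁.update hreg₃ (by
      rw [← hsb₂.adj]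
      simp [hs₃, Store.setReg, Store.setArr])
  have h5₃ : s₃.reg 5 = 0 := hS₃.r5
  have hloop := (hi₂.trans hi₃).runs h5₃
  have h6₃ : s₃.reg 6 = j := by rw [hreg₃]; simpa using h6₁
  have h7₃ : s₃.reg 7 = s.reg 7 := by rw [hreg₃]; simpa using h7₁
  have h8₃ : s₃.reg 8 = s.reg 8 := by rw [hreg₃]; simpa using h8₁
  have h31₃ : s₃.arr 3 1 = c.1 := by rw [← h3₂]; simp [hs₃, Store.setReg, Store.setArr]
  have h41₃ : s₃.arr 4 1 = c.2 := by rw [← h4₂]; simp [hs₃, Store.setReg, Store.setArr]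
  have hvis₃ : s₃.arr 5 = Function.update (marks n j) j 0 := by
    rw [← hvis₁, ← hsb₂.vis]; simp [hs₃, Store.setReg, Store.setArr]
  obtain ⟨t₄, ht₄, hr₄⟩ := hκ₂ s₃ W hW hb₃
  rw [exec_rootDone γ hS₃.ready, h6₃, h7₃, h8₃, h31₃, h41₃] at hr₄
  set s₄ := ((s₃.setReg 7 (s.reg 7 * c.1)).setReg 8 (s.reg 8 * c.2)).setArr 5 j 1 with hs₄
  have hne : s.reg 6 ≠ 0 := by rw [h6]; omega
  refine ⟨_, s₄, .step hne (hr₁.seq (hloop.seq hr₄)) (.refl _), ?_,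
    ⟨?_, ?_, ?_, ?_, ?_, ((hb₃.setReg _ hs7).setReg _ hs8).setArr _ _ hone⟩, ?_, ?_⟩
  · have h1 := hb.reg 6
    have h2 : (κ + 2) * W * (n + 1) * treeSize n E (L - 1) (marks n j) j ≤
        (κ + 2) * W * (n + 1) * B := Nat.mul_le_mul_left _ hB
    have h3 : (κ + 2) * W ≤ (κ + 2) * W * (n + 1) * B := by
      rw [mul_assoc ((κ + 2) * W)]
      exact Nat.le_mul_of_pos_right _ (Nat.mul_pos (by omega) hB1)
    have h4 : (κ + 2) * W = κ * W + 2 * W := add_mul _ _ _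
    omega
  · refine hS₃.of_reg (fun i hi => ?_) ?_ (by simp [hs₄, Store.setReg, Store.setArr])
    · simp only [hs₄, Store.setReg, Store.setArr]
      rw [Function.update_of_ne (by omega), Function.update_of_ne (by omega)]
    · simp [hs₄, Store.setReg, Store.setArr, h5₃]
  · simp [hs₄, Store.setReg, Store.setArr, h6₃]
  · rw [← update_marks_self hj, ← hvis₃]
    simp [hs₄, Store.setReg, Store.setArr]
  · simp [hs₄, hs₃, Store.setReg, Store.setArr]
  · simp [hs₄, hs₃, Store.setReg, Store.setArr]
  · simp [hs₄, Store.setReg, Store.setArr]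
  · simp [hs₄, Store.setReg, Store.setArr]

theorem run_roots {γ : ℝ} {κ W n L N g : ℕ} {E : ℕ → ℕ} (hκ : CostBound γ searchBody κ)
    (hκ₁ : CostBound γ rootInit κ) (hκ₂ : CostBound γ rootDone κ) (hW : 1 ≤ W)
    (hN : 1 ≤ N) (hL : 1 ≤ L) {B : ℕ}
    (hB : ∀ j < n, treeSize n E (L - 1) (marks n j) j ≤ B) (hB1 : 1 ≤ B) (k : ℕ) (hk : k ≤ n) :
    ∀ s, Between W n L N g E k s → 1 ≤ s.reg 7 →
    Nat.size (s.reg 7 * ∏ j ∈ Finset.range k, (treeValue n N g E (L - 1) (marks n j) j).1) ≤ W →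
    Nat.size (s.reg 8 * ∏ j ∈ Finset.range k, (treeValue n N g E (L - 1) (marks n j) j).2) ≤ W →
    ∃ t s', Iter γ 6 rootBody s t s' ∧ t ≤ k * (3 * ((κ + 2) * W * (n + 1) * B)) ∧
      Between W n L N g E 0 s' ∧
      s'.reg 7 = s.reg 7 * ∏ j ∈ Finset.range k, (treeValue n N g E (L - 1) (marks n j) j).1 ∧
      s'.reg 8 = s.reg 8 * ∏ j ∈ Finset.range k, (treeValue n N g E (L - 1) (marks n j) j).2 := by
  induction k with
  | zero => exact fun s hs h7 h7' h8' => ⟨0, s, .refl s, by simp, hs, by simp, by simp⟩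
  | succ j ih =>
    intro s hs h7 h7' h8'
    have hg : ∀ i, Good (treeValue n N g E (L - 1) (marks n i) i) :=
      fun i => treeValue_good hN E _ _ i
    have hp1 : 1 ≤ ∏ i ∈ Finset.range j, (treeValue n N g E (L - 1) (marks n i) i).1 :=
      Nat.succ_le_of_lt (Finset.prod_pos fun i _ => (hg i).1.trans (hg i).2)
    have hp2 : 1 ≤ ∏ i ∈ Finset.range j, (treeValue n N g E (L - 1) (marks n i) i).2 :=
      Nat.succ_le_of_lt (Finset.prod_pos fun i _ => (hg i).1)
    rw [Finset.prod_range_succ, mul_comm (Finset.prod _ _), ← mul_assoc] at h7' h8'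
    obtain ⟨t₁, s₁, hi₁, ht₁, hb₁, e7, e8⟩ := run_root hκ hκ₁ hκ₂ hW hN hL (by omega)
      (hB j (by omega)) hB1 hs rfl h7
      ((Nat.size_le_size (Nat.le_mul_of_pos_right _ hp1)).trans h7')
      ((Nat.size_le_size (Nat.le_mul_of_pos_right _ hp2)).trans h8')
    obtain ⟨t₂, s₂, hi₂, ht₂, hb₂, e7', e8'⟩ := ih (by omega) s₁ hb₁
      (by rw [e7]; exact Nat.mul_pos h7 ((hg j).1.trans (hg j).2)) (by rwa [e7]) (by rwa [e8])
    refine ⟨_, s₂, hi₁.trans hi₂, ?_, hb₂, ?_, ?_⟩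
    · rw [add_mul, one_mul]; omega
    · rw [e7', e7, Finset.prod_range_succ]; ring
    · rw [e8', e8, Finset.prod_range_succ]; ring

/-! ### Parameters, depth limit and the whole program -/

/-- Compute the activity and the constant part of the depth limit. -/
def setup (k₀ k₁ k₂ : ℕ) : Prog := .ofList [.const 9 1, .arith .mul 10 0 1, .const 11 k₂,
  .arith .mul 3 10 11, .param 4 3, .const 2 k₀, .const 11 k₁, .const 12 2]

/-- Remove a binary digit from register `10`, and add register `11` to the depth limit. -/
def halveBody : Prog := .ofList [.arith .div 10 10 12, .arith .add 2 2 11]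

/-- Initialize the loop over the roots. -/
def setupRoots : Prog := .ofList [.const 11 0, .const 12 0, .const 7 1, .const 8 1, .copy 6 0]

/-- Move the result to the output registers. -/
def finish : Prog := .ofList [.copy 0 7, .copy 1 8]

/-- The approximation algorithm. -/
def algorithm (k₀ k₁ k₂ : ℕ) : Prog :=
  .seq (setup k₀ k₁ k₂) (.seq (.loop 10 halveBody) (.seq setupRoots
    (.seq (.loop 6 rootBody) finish)))

theorem size_half {x : ℕ} (hx : x ≠ 0) : Nat.size x = Nat.size (x / 2) + 1 := by
  have h := Nat.bit_bodd_div2 x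
  conv_lhs => rw [← h]
  rw [Nat.size_bit (by rwa [h]), Nat.div2_val]

theorem exec_halveBody (γ : ℝ) (s : Store) : halveBody.exec γ s =
    (s.setReg 10 (s.reg 10 / s.reg 12)).setReg 2 (s.reg 2 + s.reg 11) := by
  simp [halveBody, Prog.ofList, Prog.exec, Store.setReg, ArithOp.eval]

/-- Halving `x` until it vanishes takes `Nat.size x` rounds; this is how the machine obtains a depth
proportional to a logarithm. -/
theorem run_halve {γ : ℝ} {κ W k₁ : ℕ} (hκ : CostBound γ halveBody κ) (hW : 1 ≤ W) (x : ℕ) :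
    ∀ s : Store, s.reg 10 = x → s.reg 12 = 2 → s.reg 11 = k₁ → Bounded W s →
    Nat.size (s.reg 2 + k₁ * Nat.size x) ≤ W →
    ∃ t, Iter γ 10 halveBody s t ((s.setReg 10 0).setReg 2 (s.reg 2 + k₁ * Nat.size x)) ∧
      t ≤ (κ + 2) * W * Nat.size x := by
  induction x using Nat.strong_induction_on with
  | _ x ih =>
    intro s h10 h12 h11 hb hs
    by_cases hx : x = 0
    · subst hx
      refine ⟨0, ?_, by simp⟩
      have : (s.setReg 10 0).setReg 2 (s.reg 2 + k₁ * Nat.size 0) = s := by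
        refine Store.ext' ?_ rfl
        simp only [Store.setReg, Nat.size_zero, mul_zero, add_zero]
        funext i
        simp only [Function.update_apply]
        split_ifs <;> simp_all
      rw [this]
      exact .refl s
    · obtain ⟨t₁, ht₁, hi₁⟩ := Iter.exec_step (hκ s W hW hb) hW hb (by rwa [h10])
      rw [exec_halveBody, h10, h12, h11] at hi₁
      rw [size_half hx, mul_add, mul_one] at hs ⊢
      set s₁ := (s.setReg 10 (x / 2)).setReg 2 (s.reg 2 + k₁) with hs₁
      have e2 : s₁.reg 2 = s.reg 2 + k₁ := by simp [hs₁, Store.setReg]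
      have hx10 : Nat.size x ≤ W := h10 ▸ hb.reg 10
      have hle : Nat.size (s.reg 2 + k₁) ≤ W := (Nat.size_le_size (by omega)).trans hs
      obtain ⟨t₂, hi₂, ht₂⟩ := ih (x / 2) (by omega) s₁ (by simp [hs₁, Store.setReg])
        (by simp [hs₁, Store.setReg, h12]) (by simp [hs₁, Store.setReg, h11])
        ((hb.setReg _ ((Nat.size_le_size (Nat.div_le_self x 2)).trans hx10)).setReg _ hle)
        (by rw [e2, add_assoc, add_comm k₁]; exact hs)
      refine ⟨t₁ + t₂, ?_, by rw [mul_add, mul_one]; omega⟩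
      refine hi₁.trans ?_
      convert hi₂ using 1
      refine Store.ext' ?_ rfl
      rw [e2]
      simp only [hs₁, Store.setReg]
      funext i
      simp only [Function.update_apply]
      split_ifs <;> first | rfl | omega

theorem CostBound.mono {γ : ℝ} {P : Prog} {κ κ' : ℕ} (h : CostBound γ P κ) (hκ : κ ≤ κ') :
    CostBound γ P κ' := by
  intro s W hW hb
  obtain ⟨t, ht, hr⟩ := h s W hW hb
  exact ⟨t, ht.trans (Nat.mul_le_mul_right _ hκ), hr⟩

theorem exists_costBound (γ : ℝ) (P : Prog) (hP : P.LoopFree) : ∃ κ, CostBound γ P κ := by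
  obtain ⟨κ, -, h⟩ := exists_exec_bound γ P hP
  exact ⟨κ, fun s W hW hb => (h s W hW hb).1⟩

/-- Here `B` bounds the search trees and `W` all bit lengths. Each of the `n` roots costs at most
about `(n + 1) B` search iterations, and an iteration costs `O(W)`. -/
theorem algorithm_runs (γ : ℝ) (k₀ k₁ k₂ : ℕ) (hk₀ : 1 ≤ k₀) (hk₂ : 1 ≤ k₂) :
    ∃ κ : ℕ, ∀ (n m B W N g L : ℕ) (E : ℕ → ℕ) (s : Store), 1 ≤ n → 1 ≤ m → 1 ≤ B →
      N = n * m * k₂ → g = ⌊γ * (N : ℝ)⌋₊ → L = k₀ + k₁ * Nat.size (n * m) →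
      s.reg 0 = n → s.reg 1 = m → (∀ i, 2 ≤ i → s.reg i = 0) → s.arr 0 = E →
      (∀ k i, k ≠ 0 → s.arr k i = 0) → (∀ i, E i ≤ 1) →
      (∀ j < n, treeSize n E (L - 1) (marks n j) j ≤ B) →
      3 ≤ W → k₀ ≤ W → k₁ ≤ W → Nat.size N ≤ W → Nat.size g ≤ W → Nat.size L ≤ W →
      Nat.size (n * m) ≤ W →
      Nat.size (∏ j ∈ Finset.range n, (treeValue n N g E (L - 1) (marks n j) j).1) ≤ W →
      ∃ t s', Runs γ (algorithm k₀ k₁ k₂) s t s' ∧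
        t ≤ κ * W * ((n + 1) * (n + 1) * B + Nat.size (n * m)) ∧
        s'.reg 0 = ∏ j ∈ Finset.range n, (treeValue n N g E (L - 1) (marks n j) j).1 ∧
        s'.reg 1 = ∏ j ∈ Finset.range n, (treeValue n N g E (L - 1) (marks n j) j).2 := by
  obtain ⟨κ₁, h₁⟩ := exists_costBound γ searchBody searchBody_loopFree
  obtain ⟨κ₂, h₂⟩ := exists_costBound γ rootInit rootInit_loopFree
  obtain ⟨κ₃, h₃⟩ := exists_costBound γ rootDone rootDone_loopFree
  obtain ⟨κ₄, h₄⟩ := exists_costBound γ halveBody (by simp [halveBody, Prog.ofList, Prog.LoopFree])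
  obtain ⟨κ₅, h₅⟩ := exists_costBound γ (setup k₀ k₁ k₂)
    (by simp [setup, Prog.ofList, Prog.LoopFree])
  obtain ⟨κ₆, h₆⟩ := exists_costBound γ setupRoots
    (by simp [setupRoots, Prog.ofList, Prog.LoopFree])
  obtain ⟨κ₇, h₇⟩ := exists_costBound γ finish (by simp [finish, Prog.ofList, Prog.LoopFree])
  set κ := κ₁ + κ₂ + κ₃ + κ₄ + κ₅ + κ₆ + κ₇ with hκ
  replace h₁ := h₁.mono (show κ₁ ≤ κ by omega)
  replace h₂ := h₂.mono (show κ₂ ≤ κ by omega)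
  replace h₃ := h₃.mono (show κ₃ ≤ κ by omega)
  replace h₄ := h₄.mono (show κ₄ ≤ κ by omega)
  replace h₅ := h₅.mono (show κ₅ ≤ κ by omega)
  replace h₆ := h₆.mono (show κ₆ ≤ κ by omega)
  replace h₇ := h₇.mono (show κ₇ ≤ κ by omega)
  clear_value κ
  refine ⟨8 * (κ + 2), ?_⟩
  intro n m B W N g L E s hn hm hB hN hg hL r0 r1 r2 a0 ak hE htree hW3 hk₀W hk₁W hNW hgW hLW
    hnmW hprod
  have hW : 1 ≤ W := by omega
  have hone : Nat.size 1 ≤ W := by simpa using hW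
  have hN1 : 1 ≤ N := by rw [hN]; exact Nat.mul_pos (Nat.mul_pos hn hm) hk₂
  have hnW : Nat.size n ≤ W := (Nat.size_le_size (Nat.le_mul_of_pos_right _ hm)).trans hnmW
  have hmW : Nat.size m ≤ W := (Nat.size_le_size (Nat.le_mul_of_pos_left _ hn)).trans hnmW
  have hb : Bounded W s := by
    refine ⟨fun i => ?_, fun k i => ?_⟩
    · rcases i with _ | _ | i
      · rw [r0]; exact hnW
      · rw [zero_add, r1]; exact hmW
      · rw [r2 _ (by omega)]; simp
    · by_cases hk : k = 0
      · rw [hk, a0]; exact (Nat.size_le_size (hE i)).trans hone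
      · rw [ak k i hk]; simp
  obtain ⟨t₁, ht₁, hr₁⟩ := h₅ s W hW hb
  have e₁ : (setup k₀ k₁ k₂).exec γ s = ((((((s.setReg 9 1).setReg 10 (n * m)).setReg 3 N).setReg
      4 g).setReg 2 k₀).setReg 11 k₁).setReg 12 2 := by
    simp [setup, Prog.ofList, Prog.exec, Store.setReg, ArithOp.eval, r0, r1, hg, hN]
    funext i
    simp only [Function.update_apply]
    split_ifs <;> simp_all
  rw [e₁] at hr₁
  set s₁ := ((((((s.setReg 9 1).setReg 10 (n * m)).setReg 3 N).setReg
      4 g).setReg 2 k₀).setReg 11 k₁).setReg 12 2 with hs₁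
  have hb₁ : Bounded W s₁ :=
    ((((((hb.setReg _ hone).setReg _ hnmW).setReg _ hNW).setReg _ hgW).setReg _
      ((size_le_self _).trans hk₀W)).setReg _ ((size_le_self _).trans hk₁W)).setReg _
      ((size_le_self _).trans (by omega))
  have e2 : s₁.reg 2 = k₀ := by simp [hs₁, Store.setReg]
  obtain ⟨t₂, hi₂, ht₂⟩ := run_halve (k₁ := k₁) h₄ hW (n * m) s₁ (by simp [hs₁, Store.setReg])
    (by simp [hs₁, Store.setReg]) (by simp [hs₁, Store.setReg]) hb₁ (by rw [e2, ← hL]; exact hLW)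
  rw [e2, ← hL] at hi₂
  set s₂ := (s₁.setReg 10 0).setReg 2 L with hs₂
  have hb₂ : Bounded W s₂ := (hb₁.setReg _ (by simp)).setReg _ hLW
  have hr₂ := hi₂.runs (by simp [hs₂, Store.setReg])
  obtain ⟨t₃, ht₃, hr₃⟩ := h₆ s₂ W hW hb₂
  have e₃ : setupRoots.exec γ s₂ = ((((s₂.setReg 11 0).setReg 12 0).setReg 7 1).setReg 8
      1).setReg 6 n := by
    simp [setupRoots, Prog.ofList, Prog.exec, Store.setReg, hs₂, hs₁, r0]
  rw [e₃] at hr₃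
  set s₃ := ((((s₂.setReg 11 0).setReg 12 0).setReg 7 1).setReg 8 1).setReg 6 n with hs₃
  have hb₃ : Bounded W s₃ :=
    ((((hb₂.setReg _ (by simp)).setReg _ (by simp)).setReg _ hone).setReg _ hone).setReg _ hnW
  have harr : s₃.arr = s.arr := rfl
  have hbet : Between W n L N g E n s₃ := by
    refine ⟨⟨⟨?_, ?_⟩, ?_, ?_, ?_, ?_, ?_, ?_⟩, ?_, ?_, ?_, ?_, hb₃⟩
    · simp [hs₃, hs₂, hs₁, Store.setReg]
    · simp [hs₃, hs₂, hs₁, Store.setReg, r2]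
    · simp [hs₃, hs₂, hs₁, Store.setReg, r0]
    · simp [hs₃, hs₂, hs₁, Store.setReg]
    · simp [hs₃, hs₂, hs₁, Store.setReg]
    · simp [hs₃, hs₂, hs₁, Store.setReg]
    · simp [hs₃, hs₂, hs₁, Store.setReg, r2]
    · rw [harr, a0]
    · simp [hs₃, Store.setReg]
    · rw [harr]
      funext i
      -- The clause `i < n` makes `marks n n` vanish identically, in agreement with the blank array.
      rw [ak 5 i (by omega), marks, if_neg (by omega)]
    · rw [harr, ak 3 0 (by omega)]
    · rw [harr, ak 4 0 (by omega)]
  have e7 : s₃.reg 7 = 1 := by simp [hs₃, Store.setReg]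
  have e8 : s₃.reg 8 = 1 := by simp [hs₃, Store.setReg]
  have hg : ∀ i, Good (treeValue n N g E (L - 1) (marks n i) i) :=
    fun i => treeValue_good hN1 E _ _ i
  obtain ⟨t₄, s₄, hi₄, ht₄, hbet₄, e7', e8'⟩ := run_roots h₁ h₂ h₃ hW hN1
    (show 1 ≤ L by omega) htree hB n le_rfl s₃ hbet e7.ge (by rwa [e7, one_mul])
    (by
      rw [e8, one_mul]
      exact (Nat.size_le_size (Finset.prod_le_prod' fun i _ => (hg i).2)).trans hprod)
  rw [e7, one_mul] at e7'
  rw [e8, one_mul] at e8'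
  have hr₄ := hi₄.runs hbet₄.r6
  obtain ⟨t₅, ht₅, hr₅⟩ := h₇ s₄ W hW hbet₄.bounded
  refine ⟨_, _, hr₁.seq (hr₂.seq (hr₃.seq (hr₄.seq hr₅))), ?_, ?_, ?_⟩
  · set T := (κ + 2) * W with hT
    have hT' : T = κ * W + 2 * W := add_mul _ _ _
    set Q := T * ((n + 1) * (n + 1) * B) with hQ
    have q1 : T ≤ Q := Nat.le_mul_of_pos_right _ (Nat.mul_pos (Nat.mul_pos (by omega) (by omega)) hB)
    have q2 : n * (3 * (T * (n + 1) * B)) ≤ 3 * Q := by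
      calc n * (3 * (T * (n + 1) * B)) ≤ (n + 1) * (3 * (T * (n + 1) * B)) :=
            Nat.mul_le_mul_right _ (by omega)
        _ = 3 * Q := by rw [hQ]; ring
    have q3 : 8 * (κ + 2) * W * ((n + 1) * (n + 1) * B + Nat.size (n * m)) =
        8 * Q + 8 * (T * Nat.size (n * m)) := by rw [hQ, hT]; ring
    rw [q3]
    omega
  · simp [finish, Prog.ofList, Prog.exec, Store.setReg, e7']
  · simp [finish, Prog.ofList, Prog.exec, Store.setReg, e8']

/-! ### The search computes the truncated recurrence -/

theorem sum_map_range {M : Type*} [AddCommMonoid M] (n : ℕ) (f : ℕ → M) :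
    ((List.range n).map f).sum = ∑ i : Fin n, f i := by
  rw [← Finset.sum_range]
  rfl

/-- `comb` sends `A / B` and the child value `C / D` to `A / B + (g / N) (D / C)`: frames store the
inverse probability `1 / x`, to which each child adds its activity term. -/
theorem foldl_comb_ratio {N g : ℕ} (hN : 1 ≤ N) (p : ℕ → Prop) [DecidablePred p]
    (f : ℕ → ℕ × ℕ) (hf : ∀ u, Good (f u)) (l : List ℕ) {a : ℕ × ℕ} (ha : Good a) :
    (((l.foldl (fun a u => if p u then a else comb N g a (f u)) a).1 : ℕ) : ℝ) /
        ((l.foldl (fun a u => if p u then a else comb N g a (f u)) a).2 : ℕ) =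
      (a.1 : ℝ) / a.2 + (g : ℝ) / N *
        (l.map fun u => if p u then (0 : ℝ) else ((f u).2 : ℝ) / (f u).1).sum := by
  induction l generalizing a with
  | nil => simp
  | cons u l ih =>
    rw [List.foldl_cons, List.map_cons, List.sum_cons]
    split_ifs with h
    · rw [ih ha, zero_add]
    · rw [ih (ha.comb hN (hf u)).1]
      have h1 : (0 : ℝ) < N := by exact_mod_cast hN
      have h2 : (0 : ℝ) < a.2 := by exact_mod_cast ha.1
      have h3 : (0 : ℝ) < (f u).1 := by exact_mod_cast (hf u).1.trans (hf u).2
      have h4 : (((comb N g a (f u)).1 : ℕ) : ℝ) / ((comb N g a (f u)).2 : ℕ) =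
          (a.1 : ℝ) / a.2 + (g : ℝ) / N * (((f u).2 : ℝ) / (f u).1) := by
        simp only [comb]; push_cast; field_simp
      rw [h4]; ring

/-- The array `E` is the adjacency matrix of `G`, row by row. -/
def IsAdjacency {n : ℕ} (G : SimpleGraph (Fin n)) (E : ℕ → ℕ) : Prop :=
  ∀ v u : Fin n, E ((v : ℕ) * n + u) ≠ 0 ↔ G.Adj v u

/-- The vertices marked by `vis` are those of `X`. -/
def IsMarking {n : ℕ} (X : Finset (Fin n)) (vis : ℕ → ℕ) : Prop :=
  ∀ i : Fin n, vis i = if i ∈ X then 1 else 0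

theorem IsMarking.update {n : ℕ} {X : Finset (Fin n)} {vis : ℕ → ℕ} (h : IsMarking X vis)
    (u : Fin n) : IsMarking (insert u X) (Function.update vis u 1) := by
  intro i
  rw [Function.update_apply, h i]
  simp only [Finset.mem_insert, Fin.ext_iff]
  split_ifs <;> simp_all

theorem candidate_iff {n : ℕ} {G : SimpleGraph (Fin n)} {E : ℕ → ℕ} (hE : IsAdjacency G E)
    {X : Finset (Fin n)} {vis : ℕ → ℕ} (h : IsMarking X vis) (v u : Fin n) :
    E ((v : ℕ) * n + u) * (1 - vis u) = 0 ↔ ¬ u ∈ succs G X v := by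
  rw [mem_succs, ← hE, h u]
  by_cases hu : u ∈ X <;> simp [hu]

theorem sum_candidates {M : Type*} [AddCommMonoid M] {n : ℕ} {G : SimpleGraph (Fin n)}
    {E : ℕ → ℕ} (hE : IsAdjacency G E) {X : Finset (Fin n)} {vis : ℕ → ℕ} (h : IsMarking X vis)
    (v : Fin n) (f : ℕ → M) :
    ((List.range n).map fun u => if E ((v : ℕ) * n + u) * (1 - vis u) = 0 then 0 else f u).sum =
      ∑ u ∈ succs G X v, f u := by
  classical
  rw [sum_map_range]
  simp only [candidate_iff hE h, ite_not]
  rw [← Finset.sum_filter]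
  congr 1
  ext u; simp

theorem treeSize_eq {n : ℕ} {G : SimpleGraph (Fin n)} {E : ℕ → ℕ} (hE : IsAdjacency G E) (r : ℕ)
    {X : Finset (Fin n)} {vis : ℕ → ℕ} (h : IsMarking X vis) (v : Fin n) :
    treeSize n E r vis v = nodeCount G r X v := by
  induction r generalizing X vis v with
  | zero => rw [treeSize, nodeCount_zero]
  | succ r ih =>
    rw [treeSize, nodeCount_succ, sum_candidates hE h v]
    congr 1
    exact Finset.sum_congr rfl fun u _ => ih (h.update u) u

theorem treeValue_eq {n N g : ℕ} (hN : 1 ≤ N) {G : SimpleGraph (Fin n)} {E : ℕ → ℕ}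
    (hE : IsAdjacency G E) (r : ℕ) {X : Finset (Fin n)} {vis : ℕ → ℕ} (h : IsMarking X vis)
    (v : Fin n) :
    ((treeValue n N g E r vis v).1 : ℝ) / (treeValue n N g E r vis v).2 =
      1 / truncated ((g : ℝ) / N) G r X v := by
  induction r generalizing X vis v with
  | zero => simp [treeValue, truncated]
  | succ r ih =>
    rw [treeValue, truncated, one_div_one_div,
      foldl_comb_ratio hN _ _ (fun u => treeValue_good hN E r _ u) _ (by simp [Good]),
      sum_candidates hE h v]
    congr 1
    · simp
    · congr 1
      refine Finset.sum_congr rfl fun u _ => ?_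
      rw [← inv_div, ih (h.update u) u, one_div, inv_inv]

theorem isMarking_marks (n j : ℕ) : IsMarking (upper n j) (marks n j) := by
  intro i
  simp [marks, mem_upper]

/-- Since denominators are at most numerators, `comb` multiplies the two numerators and at most a
factor `N + g`. So the numerator times `N + g` is submultiplicative, and the exponents add up like
numbers of nodes. -/
theorem foldl_comb_le {N g : ℕ} (p : ℕ → Prop) [DecidablePred p] (f : ℕ → ℕ × ℕ)
    (w : ℕ → ℕ) (hf : ∀ u, (f u).2 ≤ (f u).1) (hw : ∀ u, (f u).1 * (N + g) ≤ (N + g) ^ w u)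
    (l : List ℕ) {a : ℕ × ℕ} {k : ℕ} (ha : a.2 ≤ a.1) (hk : a.1 * (N + g) ≤ (N + g) ^ k) :
    (l.foldl (fun a u => if p u then a else comb N g a (f u)) a).1 * (N + g) ≤
      (N + g) ^ (k + (l.map fun u => if p u then 0 else w u).sum) := by
  induction l generalizing a k with
  | nil => simpa using hk
  | cons u l ih =>
    rw [List.foldl_cons, List.map_cons, List.sum_cons]
    split_ifs with h
    · rw [zero_add]; exact ih ha hk
    · rw [← add_assoc]
      refine ih ?_ ?_
      · simp only [comb]
        refine le_trans ?_ (Nat.le_add_right _ _)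
        gcongr
      · calc (comb N g a (f u)).1 * (N + g)
            ≤ (a.1 * (f u).1 * N + a.1 * (f u).1 * g) * (N + g) := by
              simp only [comb]
              gcongr
              exact hf u
          _ = (a.1 * (N + g)) * ((f u).1 * (N + g)) := by ring
          _ ≤ (N + g) ^ k * (N + g) ^ w u := Nat.mul_le_mul hk (hw u)
          _ = _ := by rw [pow_add]

theorem treeValue_le {n N g : ℕ} (hN : 1 ≤ N) (E : ℕ → ℕ) (r : ℕ) (vis : ℕ → ℕ) (v : ℕ) :
    (treeValue n N g E r vis v).1 * (N + g) ≤ (N + g) ^ treeSize n E r vis v := by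
  induction r generalizing vis v with
  | zero => simp [treeValue, treeSize]
  | succ r ih =>
    rw [treeValue, treeSize]
    exact foldl_comb_le _ _ (fun u => treeSize n E r (Function.update vis u 1) u)
      (fun u => (treeValue_good hN E r _ u).2) (fun u => ih _ u) _ le_rfl (by simp)

theorem size_pow_le (x k : ℕ) : Nat.size (x ^ k) ≤ k * Nat.size x + 1 := by
  rw [Nat.size_le]
  calc x ^ k ≤ (2 ^ Nat.size x) ^ k := Nat.pow_le_pow_left (Nat.lt_size_self x).le k
    _ = 2 ^ (k * Nat.size x) := by rw [← pow_mul, mul_comm]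
    _ < _ := Nat.pow_lt_pow_right (by norm_num) (by omega)

/-- The bit length of `N + g` is bounded crudely by `N + g` itself; this only affects the constant
part of the exponent. -/
theorem size_prod_treeValue_le {n N g B r : ℕ} (hN : 1 ≤ N) (E : ℕ → ℕ)
    (hB : ∀ j < n, treeSize n E r (marks n j) j ≤ B) :
    Nat.size (∏ j ∈ Finset.range n, (treeValue n N g E r (marks n j) j).1) ≤
      n * B * (N + g) + 1 := by
  have h : ∏ j ∈ Finset.range n, (treeValue n N g E r (marks n j) j).1 ≤ (N + g) ^ (n * B) := by
    calc _ ≤ ∏ _j ∈ Finset.range n, (N + g) ^ B := by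
          refine Finset.prod_le_prod' fun j hj => ?_
          refine le_trans (Nat.le_mul_of_pos_right _ (by omega)) ((treeValue_le hN E r _ j).trans ?_)
          exact Nat.pow_le_pow_right (by omega) (hB j (Finset.mem_range.1 hj))
      _ = _ := by rw [Finset.prod_const, Finset.card_range, ← pow_mul, mul_comm]
  refine (Nat.size_le_size h).trans ((size_pow_le _ _).trans ?_)
  gcongr
  exact size_le_self _

theorem isAdjacency_inputStore (G : FinGraph) (m : ℕ) :
    IsAdjacency G.2 ((inputStore G m).arr 0) := by
  intro v u
  simp only [inputStore, true_and, ne_eq, ite_eq_right_iff, one_ne_zero, imp_false, not_not]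
  constructor
  · rintro ⟨i, j, h, hadj⟩
    have hn : 0 < G.1 := v.pos
    -- The column is the remainder of the index modulo the number of vertices.
    have e1 : (u : ℕ) = j := by
      have := congrArg (· % G.1) h
      simpa [Nat.add_mod, Nat.mod_eq_of_lt u.2, Nat.mod_eq_of_lt j.2] using this
    have e2 : (v : ℕ) = i := by
      rw [e1] at h
      exact Nat.eq_of_mul_eq_mul_right hn (by omega)
    rw [Fin.ext e1, Fin.ext e2]
    exact hadj
  · exact fun h => ⟨v, u, rfl, h⟩

/-! ### The main theorem -/

theorem two_pow_size_le {x : ℕ} (hx : 1 ≤ x) : 2 ^ Nat.size x ≤ 2 * x := by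
  have h1 : Nat.size x ≠ 0 := by rw [Ne, Nat.size_eq_zero]; omega
  obtain ⟨k, hk⟩ := Nat.exists_eq_succ_of_ne_zero h1
  have : 2 ^ k ≤ x := Nat.lt_size.1 (by omega)
  rw [hk, pow_succ]; omega

/-- The factor `2` is a rounding of `1 / log 2`. -/
theorem size_le_log {x : ℕ} (hx : 1 ≤ x) : (Nat.size x : ℝ) ≤ 1 + 2 * Real.log x := by
  have h : ((2 : ℝ)) ^ Nat.size x ≤ 2 * x := by exact_mod_cast two_pow_size_le hx
  have hx' : (1 : ℝ) ≤ x := by exact_mod_cast hx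
  have h' := Real.log_le_log (by positivity) h
  rw [Real.log_pow, Real.log_mul (by norm_num) (by positivity)] at h'
  have h2 := Real.log_two_gt_d9
  have h3 := Real.log_nonneg hx'
  by_contra hcon
  push Not at hcon
  nlinarith

theorem log_le_size {x : ℕ} (hx : 1 ≤ x) : Real.log x ≤ Nat.size x := by
  have h : (x : ℝ) ≤ 2 ^ Nat.size x := by exact_mod_cast (Nat.lt_size_self x).le
  have hx' : (0 : ℝ) < x := by exact_mod_cast hx
  have h' := Real.log_le_log hx' h
  rw [Real.log_pow] at h'
  have h2 := Real.log_two_lt_d9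
  have : (0 : ℝ) ≤ Nat.size x := Nat.cast_nonneg _
  nlinarith

/-- The growth of the search trees with the size of the input. -/
theorem pow_depth_le {Δ y : ℝ} (hΔ : 1 ≤ Δ) {x k₀ k₁ : ℕ} (hx : 1 ≤ x) (hy : 1 ≤ y)
    (hxy : (x : ℝ) ≤ 2 * y) :
    Δ ^ (k₀ + k₁ * Nat.size x) ≤ Δ ^ (k₀ + 3 * k₁) * y ^ (2 * k₁ * Real.log Δ) := by
  have hΔ0 : 0 < Δ := by linarith
  have hy0 : 0 < y := by linarith
  have hl := Real.log_nonneg hΔ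
  have hs : (Nat.size x : ℝ) ≤ 3 + 2 * Real.log y := by
    have h1 := size_le_log hx
    have h2 := Real.log_le_log (by exact_mod_cast hx) hxy
    rw [Real.log_mul (by norm_num) hy0.ne'] at h2
    have h3 := Real.log_two_lt_d9
    linarith
  have e : ∀ k : ℕ, Δ ^ k = Real.exp (k * Real.log Δ) := fun k => by
    rw [Real.exp_nat_mul, Real.exp_log hΔ0]
  rw [e, e, Real.rpow_def_of_pos hy0, ← Real.exp_add, Real.exp_le_exp]
  push_cast
  have : (k₁ : ℝ) * Real.log Δ * Nat.size x ≤ k₁ * Real.log Δ * (3 + 2 * Real.log y) :=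
    mul_le_mul_of_nonneg_left hs (by positivity)
  linarith

/-- The hypothesis does not count the root; `max c 1` accounts for it and gives a positive constant
whatever `c` is. -/
theorem nodeCount_le_of_connectiveConstant {F : Set FinGraph} {Δ a c : ℝ} (hΔ : 1 ≤ Δ)
    (hF : ConnectiveConstantAtMost F Δ a c) {G : FinGraph} (hG : G ∈ F) {l : ℕ}
    (hl : a * Real.log (G.1 : ℝ) ≤ l) {X : Finset (Fin G.1)} {v : Fin G.1} (hv : v ∈ X) :
    (nodeCount G.2 l X v : ℝ) ≤ 2 * max c 1 * Δ ^ l := by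
  have h1 : (nodeCount G.2 l X v : ℝ) ≤ 1 + ((∑ i ∈ Finset.Icc 1 l, numSAW G.2 v i : ℕ) : ℝ) := by
    exact_mod_cast nodeCount_le G.2 l hv
  have h2 := hF G hG v l hl
  have h3 : 1 ≤ Δ ^ l := one_le_pow₀ hΔ
  have h4 : c * Δ ^ l ≤ max c 1 * Δ ^ l :=
    mul_le_mul_of_nonneg_right (le_max_left _ _) (by linarith)
  have h5 : 1 * Δ ^ l ≤ max c 1 * Δ ^ l :=
    mul_le_mul_of_nonneg_right (le_max_right _ _) (by linarith)
  linarith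

/-- The rounded activity. -/
theorem floor_activity {γ : ℝ} (hγ : 0 < γ) {k n m N : ℕ} (hk : 4 / γ ≤ k) (hn : 0 < n)
    (hm : 0 < m) (hN : N = n * m * k) (hN1 : 1 ≤ N) :
    (⌊γ * (N : ℝ)⌋₊ : ℝ) / N ≤ γ ∧ (1 - 1 / (4 * n * m)) * γ ≤ (⌊γ * (N : ℝ)⌋₊ : ℝ) / N := by
  have hn' : (0 : ℝ) < n := by exact_mod_cast hn
  have hm' : (0 : ℝ) < m := by exact_mod_cast hm
  have hN' : (0 : ℝ) < N := by exact_mod_cast hN1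
  constructor
  · rw [div_le_iff₀ hN']
    exact Nat.floor_le (by positivity)
  · rw [le_div_iff₀ hN']
    have h1 := Nat.sub_one_lt_floor (γ * (N : ℝ))
    have h2 : 1 ≤ 1 / (4 * n * m) * γ * (N : ℝ) := by
      rw [div_le_iff₀ hγ] at hk
      rw [hN]; push_cast
      have : 1 / (4 * n * m) * γ * ((n : ℝ) * m * k) = k * γ / 4 := by field_simp
      rw [this]; linarith
    linarith

/-- The bit lengths and the cost of a run, in terms of the size of the input. -/
theorem cost_arith {κ ω n x B s t : ℕ} (hx : 1 ≤ x) (hn1 : 1 ≤ n) (hn : n ≤ x) (hB : 1 ≤ B)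
    (hs : s ≤ x)
    (ht : t ≤ κ * (ω * (x * x * B)) * ((n + 1) * (n + 1) * B + s)) :
    t ≤ 5 * κ * ω * (x ^ 4 * B ^ 2) := by
  refine ht.trans ?_
  have h1 : (n + 1) * (n + 1) * B + s ≤ 5 * (x * x * B) := by
    have h2 : (n + 1) * (n + 1) ≤ (2 * x) * (2 * x) := Nat.mul_le_mul (by omega) (by omega)
    have h3 : (n + 1) * (n + 1) * B ≤ (2 * x) * (2 * x) * B := Nat.mul_le_mul_right _ h2
    have h4 : s ≤ x * x * B := by
      rw [mul_assoc]; exact hs.trans (Nat.le_mul_of_pos_right _ (Nat.mul_pos hx hB))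
    nlinarith
  calc _ ≤ κ * (ω * (x * x * B)) * (5 * (x * x * B)) := Nat.mul_le_mul_left _ h1
    _ = _ := by ring

/-- The separate bound on `k₁` matters: `k₁` is the coefficient of the logarithm in the depth and
ends up in the exponent, whereas `k₀` and `D` may depend on all the data. -/
theorem exists_algorithm {F : Set FinGraph} {γ Δ a c : ℝ} (hγ : 0 < γ) (hΔ : 1 ≤ Δ)
    (hF : ConnectiveConstantAtMost F Δ a c) :
    ∃ (k₀ k₁ : ℕ) (P : Prog) (D : ℝ), 0 ≤ D ∧
      (k₁ : ℝ) ≤ 6 * √(γ * Δ) + 4 + ⌈a⌉₊ ∧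
      ∀ G ∈ F, 0 < G.1 → ∀ ε : ℝ, 0 < ε → ε ≤ 1 →
        ∃ (t : ℕ) (s : Store), Runs γ P (inputStore G ⌈1 / ε⌉₊) t s ∧
          (t : ℝ) ≤ D * (((G.1 * ⌈1 / ε⌉₊ : ℕ) : ℝ) ^ 4 *
            (Δ ^ (k₀ + k₁ * Nat.size (G.1 * ⌈1 / ε⌉₊))) ^ 2) ∧
          s.reg 1 ≠ 0 ∧
          (1 - ε) * partitionFunction γ G.2 ≤ output s ∧
          output s ≤ (1 + ε) * partitionFunction γ G.2 := by
  -- `3² ≥ 8` gives the condition `8γΔ ≤ (q + 1)²`.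
  set q := ⌈3 * √(γ * Δ)⌉₊ with hqdef
  set c₁ := 2 * max c 1 with hc₁
  have hc2 : 2 ≤ c₁ := by have := le_max_right c 1; linarith
  -- `2 (q + 1)` makes `2 ^ l` beat `(n²m) ^ (q + 1)`; `⌈a⌉₊` ensures `l ≥ a log n`.
  set k₁ := 2 * (q + 1) + ⌈a⌉₊ with hk₁
  -- `k₀` absorbs the factors that do not depend on the input.
  obtain ⟨k₀, hk₀⟩ := pow_unbounded_of_one_lt (c₁ * (8 * γ) ^ (q + 1)) (by norm_num : (1 : ℝ) < 2)
  -- Fine enough that rounding down changes the activity by a relative error of at most `1 / (4nm)`.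
  set k₂ := ⌈4 / γ⌉₊ with hk₂
  have hk₂1 : 1 ≤ k₂ := Nat.one_le_ceil_iff.2 (by positivity)
  -- `k₀ + 1` because the root already has depth `1`.
  obtain ⟨κ, hκ⟩ := algorithm_runs γ (k₀ + 1) k₁ k₂ (by omega) hk₂1
  -- With this constant, `ω x² B` bounds every bit length in the run, where `x = nm`.
  set ω := 4 + (k₀ + 1) + k₁ + (k₂ + ⌈γ⌉₊ * k₂) with hω
  have hsq : √(γ * Δ) ^ 2 = γ * Δ := Real.sq_sqrt (by positivity)
  have hsq0 : 0 ≤ √(γ * Δ) := Real.sqrt_nonneg _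
  have hq : 8 * γ * Δ ≤ ((q + 1 : ℕ) : ℝ) ^ 2 := by
    have h1 : 3 * √(γ * Δ) ≤ ((q + 1 : ℕ) : ℝ) := by
      push_cast
      linarith [Nat.le_ceil (3 * √(γ * Δ))]
    have h2 := pow_le_pow_left₀ (by positivity) h1 2
    have h3 : 0 < γ * Δ := by positivity
    rw [mul_pow, hsq] at h2
    linarith
  refine ⟨k₀, k₁, algorithm (k₀ + 1) k₁ k₂, 5 * κ * ω * c₁ ^ 2, by positivity, ?_, ?_⟩
  · have h1 := Nat.ceil_lt_add_one (a := 3 * √(γ * Δ)) (by positivity)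
    rw [hk₁]; push_cast
    linarith
  intro G hG hn ε hε0 hε1
  set n := G.1 with hndef
  set m := ⌈1 / ε⌉₊ with hmdef
  have hm : 0 < m := Nat.ceil_pos.2 (by positivity)
  set x := n * m with hx
  have hx1 : 1 ≤ x := Nat.mul_pos hn hm
  set l := k₀ + k₁ * Nat.size x with hldef
  set N := x * k₂ with hN
  have hN1 : 1 ≤ N := Nat.mul_pos hx1 hk₂1
  set g := ⌊γ * (N : ℝ)⌋₊ with hg
  set E := (inputStore G m).arr 0 with hEdef
  have hE : IsAdjacency G.2 E := isAdjacency_inputStore G m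
  have hnx : n ≤ x := Nat.le_mul_of_pos_right _ hm
  have hal : a * Real.log (n : ℝ) ≤ l := by
    have h1 : Real.log (n : ℝ) ≤ Nat.size x := by
      refine (log_le_size hn).trans ?_
      exact_mod_cast Nat.size_le_size hnx
    have h0 : 0 ≤ Real.log (n : ℝ) := Real.log_natCast_nonneg n
    calc a * Real.log (n : ℝ) ≤ ⌈a⌉₊ * Real.log (n : ℝ) :=
          mul_le_mul_of_nonneg_right (Nat.le_ceil a) h0
      _ ≤ ⌈a⌉₊ * Nat.size x := mul_le_mul_of_nonneg_left h1 (Nat.cast_nonneg _)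
      _ ≤ l := by
          have : ⌈a⌉₊ * Nat.size x ≤ l := by
            rw [hldef, hk₁, add_mul]; omega
          exact_mod_cast this
  have hnode : ∀ (X : Finset (Fin n)) (v : Fin n), v ∈ X →
      (nodeCount G.2 l X v : ℝ) ≤ c₁ * Δ ^ l := fun X v hv =>
    nodeCount_le_of_connectiveConstant hΔ hF hG hal hv
  have hΔl : 1 ≤ Δ ^ l := one_le_pow₀ hΔ
  set B := ⌊c₁ * Δ ^ l⌋₊ with hB
  have hB1 : 1 ≤ B := Nat.le_floor (by push_cast; nlinarith)
  have hBle : (B : ℝ) ≤ c₁ * Δ ^ l := Nat.floor_le (by positivity)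
  have hL : k₀ + 1 + k₁ * Nat.size x - 1 = l := by omega
  have htree : ∀ j < n, treeSize n E l (marks n j) j ≤ B := by
    intro j hj
    have h := treeSize_eq hE l (isMarking_marks n j) ⟨j, hj⟩
    rw [Fin.val_mk] at h
    rw [h]
    exact Nat.le_floor (hnode _ _ (mem_upper.2 le_rfl))
  have hsx : Nat.size x ≤ x := size_le_self x
  have hgle : g ≤ ⌈γ⌉₊ * N := by
    refine Nat.floor_le_of_le ?_
    push_cast
    exact mul_le_mul_of_nonneg_right (Nat.le_ceil γ) (Nat.cast_nonneg _)
  have hNg : N + g ≤ (k₂ + ⌈γ⌉₊ * k₂) * x := by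
    calc N + g ≤ N + ⌈γ⌉₊ * N := by omega
      _ = _ := by rw [hN]; ring
  have hxx : x ≤ x * x * B := by
    rw [mul_assoc]; exact Nat.le_mul_of_pos_right _ (Nat.mul_pos hx1 hB1)
  have hone : 1 ≤ x * x * B := hx1.trans hxx
  set Y := x * x * B with hY
  have hωY : ∀ u, u ≤ ω → u ≤ ω * Y := fun u hu => hu.trans (Nat.le_mul_of_pos_right _ hone)
  have hωx : ∀ u z, u ≤ ω → z ≤ u * x → z ≤ ω * Y := fun u z hu hz =>
    hz.trans (Nat.mul_le_mul hu hxx)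
  obtain ⟨t, s, hr, ht, hs0, hs1⟩ := hκ n m B (ω * Y) N g (k₀ + 1 + k₁ * Nat.size x) E
    (inputStore G m) hn hm hB1 rfl rfl rfl (by simp [inputStore, hndef]) (by simp [inputStore])
    (fun i hi => by simp [inputStore, show i ≠ 0 by omega, show i ≠ 1 by omega]) rfl
    (fun k i hk => by simp [inputStore, hk])
    (fun i => by simp only [hEdef, inputStore]; split_ifs <;> omega)
    (by rw [hL]; exact htree) (hωY 3 (by omega)) (hωY _ (by omega)) (hωY _ (by omega))
    ((size_le_self _).trans (hωx (k₂ + ⌈γ⌉₊ * k₂) _ (by omega) (by omega)))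
    ((size_le_self _).trans (hωx (k₂ + ⌈γ⌉₊ * k₂) _ (by omega) (by omega)))
    ((size_le_self _).trans (hωx (k₀ + 1 + k₁) _ (by omega) (by
      rw [add_mul (k₀ + 1) k₁ x]
      exact Nat.add_le_add (Nat.le_mul_of_pos_right _ hx1) (Nat.mul_le_mul_left _ hsx))))
    (hsx.trans (hωx 1 _ (by omega) (by omega)))
    (by
      rw [hL]
      refine (size_prod_treeValue_le hN1 E htree).trans ?_
      calc n * B * (N + g) + 1 ≤ x * B * ((k₂ + ⌈γ⌉₊ * k₂) * x) + Y :=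
            Nat.add_le_add (Nat.mul_le_mul (Nat.mul_le_mul_right _ hnx) hNg) hone
        _ = (k₂ + ⌈γ⌉₊ * k₂ + 1) * Y := by rw [hY]; ring
        _ ≤ ω * Y := Nat.mul_le_mul_right _ (by omega))
  rw [hL] at hs0 hs1
  refine ⟨t, s, hr, ?_, ?_, ?_⟩
  · have h1 := cost_arith hx1 hn hnx hB1 hsx ht
    have h2 : (t : ℝ) ≤ 5 * κ * ω * ((x : ℝ) ^ 4 * (B : ℝ) ^ 2) := by exact_mod_cast h1
    refine h2.trans ?_
    calc 5 * (κ : ℝ) * ω * ((x : ℝ) ^ 4 * (B : ℝ) ^ 2)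
        ≤ 5 * κ * ω * ((x : ℝ) ^ 4 * (c₁ * Δ ^ l) ^ 2) := by gcongr
      _ = _ := by ring
  · rw [hs1]
    exact (Finset.prod_pos fun j _ => (treeValue_good hN1 E l (marks n j) j).1).ne'
  · have hout : output s = ∏ k : Fin n, 1 / truncated ((g : ℝ) / N) G.2 l (upper n k) k := by
      rw [output, hs0, hs1]
      push_cast
      rw [← Finset.prod_div_distrib, Finset.prod_range]
      exact Finset.prod_congr rfl fun k _ => treeValue_eq hN1 hE l (isMarking_marks n k) k
    rw [hout]
    obtain ⟨hγ1, hγ2⟩ := floor_activity hγ (Nat.le_ceil (4 / γ)) hn hm hN hN1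
    refine prod_truncated_approx (c := c₁) (by positivity) hγ1 hΔ hn hm (by linarith) hq G.2
      (fun X v hv => ?_) ?_ hε0 hε1 (Nat.le_ceil _) hγ2
    · refine le_trans ?_ (hnode X v hv)
      exact_mod_cast Finset.single_le_sum (f := fun i => sawCount G.2 i X v)
        (fun _ _ => Nat.zero_le _) (Finset.self_mem_range_succ l)
    · have hm1 : (1 : ℝ) ≤ m := by exact_mod_cast hm
      have hxs : (x : ℝ) ≤ 2 ^ Nat.size x := by exact_mod_cast (Nat.lt_size_self x).le
      calc c₁ * (8 * γ * (n : ℝ) ^ 2 * m) ^ (q + 1)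
          ≤ c₁ * (8 * γ * (x : ℝ) ^ 2) ^ (q + 1) := by
            rw [hx]; push_cast
            gcongr ?_ * ?_ ^ _
            rw [mul_assoc, mul_pow]
            gcongr
            nlinarith
        _ = c₁ * (8 * γ) ^ (q + 1) * (x : ℝ) ^ (2 * (q + 1)) := by
            rw [mul_pow, pow_mul]; ring
        _ ≤ 2 ^ k₀ * (2 ^ Nat.size x) ^ k₁ := by
            gcongr ?_ * ?_
            calc (x : ℝ) ^ (2 * (q + 1)) ≤ (2 ^ Nat.size x) ^ (2 * (q + 1)) := by gcongr
              _ ≤ (2 ^ Nat.size x) ^ k₁ :=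
                pow_le_pow_right₀ (one_le_pow₀ (by norm_num)) (by omega)
        _ = 2 ^ l := by rw [← pow_mul, ← pow_add, hldef, mul_comm k₁]

end MonomerDimer

theorem mainTheorem2 (a : ℝ) :
    ∃ K : ℝ, ∀ (γ Δ c : ℝ) (F : Set MonomerDimer.FinGraph), 0 < γ → 1 ≤ Δ →
      MonomerDimer.ConnectiveConstantAtMost F Δ a c →
      ∃ (P : MonomerDimer.Prog) (C : ℝ),
        MonomerDimer.ApproximatesInTime γ F P
          (fun n ε => C * ((n : ℝ) / ε) ^ (K * (1 + (1 + √(γ * Δ)) * Real.log Δ))) := by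
  -- The cost `x⁴ (Δ ^ l)²` has exponent `4 + 4 k₁ log Δ` in `n / ε`, and `k₁ ≤ (6 + ⌈a⌉₊) (1 +
  -- √(γΔ))`.
  refine ⟨4 * (6 + ⌈a⌉₊), fun γ Δ c F hγ hΔ hF => ?_⟩
  obtain ⟨k₀, k₁, P, D, hD, hk₁, h⟩ := MonomerDimer.exists_algorithm hγ hΔ hF
  refine ⟨P, D * (16 * (Δ ^ (k₀ + 3 * k₁)) ^ 2), fun G hG hn ε hε0 hε1 => ?_⟩
  obtain ⟨t, s, hr, ht, h1, h2, h3⟩ := h G hG hn ε hε0 hε1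
  refine ⟨t, s, hr, ht.trans ?_, h1, h2, h3⟩
  have hn1 : (1 : ℝ) ≤ G.1 := by exact_mod_cast hn
  have hy : 1 ≤ (G.1 : ℝ) / ε := by rw [le_div_iff₀ hε0]; linarith
  have hy0 : 0 < (G.1 : ℝ) / ε := by linarith
  have hm : 0 < ⌈1 / ε⌉₊ := Nat.ceil_pos.2 (by positivity)
  -- As `ε ≤ 1`, rounding `1 / ε` up at most doubles it.
  have hx : ((G.1 * ⌈1 / ε⌉₊ : ℕ) : ℝ) ≤ 2 * ((G.1 : ℝ) / ε) := by
    have h4 := Nat.ceil_lt_add_one (a := 1 / ε) (by positivity)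
    have h5 : 1 ≤ 1 / ε := by rw [le_div_iff₀ hε0]; linarith
    push_cast
    calc (G.1 : ℝ) * ⌈1 / ε⌉₊ ≤ G.1 * (2 * (1 / ε)) := by
          gcongr; linarith
      _ = _ := by ring
  have hp := MonomerDimer.pow_depth_le (k₀ := k₀) (k₁ := k₁) hΔ (Nat.mul_pos hn hm) hy hx
  set y := (G.1 : ℝ) / ε
  have hl := Real.log_nonneg hΔ
  dsimp only
  calc D * (((G.1 * ⌈1 / ε⌉₊ : ℕ) : ℝ) ^ 4 *
        (Δ ^ (k₀ + k₁ * Nat.size (G.1 * ⌈1 / ε⌉₊))) ^ 2)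
      ≤ D * ((2 * y) ^ 4 * (Δ ^ (k₀ + 3 * k₁) * y ^ (2 * k₁ * Real.log Δ)) ^ 2) := by
        gcongr
    _ = D * (16 * (Δ ^ (k₀ + 3 * k₁)) ^ 2) * (y ^ (4 : ℝ) * (y ^ (2 * k₁ * Real.log Δ)) ^ 2) := by
        rw [show (4 : ℝ) = ((4 : ℕ) : ℝ) by norm_num, Real.rpow_natCast]; ring
    _ = D * (16 * (Δ ^ (k₀ + 3 * k₁)) ^ 2) * y ^ (4 + 4 * k₁ * Real.log Δ) := by
        rw [← Real.rpow_mul_natCast hy0.le, ← Real.rpow_add hy0]; push_cast; ring_nf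
    _ ≤ _ := by
        refine mul_le_mul_of_nonneg_left ?_ (by positivity)
        refine Real.rpow_le_rpow_of_exponent_le hy ?_
        have hs : 0 ≤ √(γ * Δ) := Real.sqrt_nonneg _
        have ha : (0 : ℝ) ≤ ⌈a⌉₊ := Nat.cast_nonneg _
        have hk : (k₁ : ℝ) ≤ (6 + ⌈a⌉₊) * (1 + √(γ * Δ)) := by nlinarith
        have hkl := mul_le_mul_of_nonneg_right hk hl
        nlinarith
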